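/- All graphs are finite, simple and undirected. For a graph $G$ on $n$ vertices let $S(G)$ be the set of all real symmetric $n\times n$ matrices $A$ (rows and columns indexed by the vertices) such that for $i\ne j$ one has $a_{ij}\neq 0$ if and only if $ij$ is an edge of $G$ (no restriction on the diagonal), and let $M(G)$ be the maximum, over $A\in S(G)$, of the largest multiplicity of an eigenvalue of $A$. A graph is a *path* if it is the path on $n\ge 1$ vertices. A *graph of two parallel paths* is a graph that is not a path and that has two vertex-disjoint nonempty induced paths $p_1,\dots,p_k$ and $q_1,\dots,q_l$ (numbered consecutively along the paths) which together cover all vertices, such that no two edges between them cross, i.e. there are no edges $p_iq_j$ and $p_{i'}q_{j'}$ with $i<i'$ and $j>j'$ (the two paths need not be joined by an edge). A *2-tree* is a graph built from a triangle by successively adding a new vertex adjacent to exactly the two ends of an existing edge; a *partial 2-tree* is obtained from a 2-tree by deleting some edges (and no vertices). The *core* of a connected graph is its maximal induced subgraph that is connected and has minimum degree at least two. A *SEAC graph* is a graph built sequentially from cycles (of length at least 3) by articulating (gluing) each successive cycle along an edge of the previously constructed graph, no edge being used more than once for articulation. Two of its constituent cycles are *neighbors* if they share an edge of articulation; the graph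 is an *LSEAC graph* if each constituent cycle has at most two neighbors, and a constituent cycle is *terminal* if it has at most one neighbor. A *simple partial 2-tree* is a connected partial 2-tree whose core is a (nonempty) LSEAC graph and which is obtained from its core by attaching vertices of degree one to vertices of the core. A *distinguished vertex* of it is a vertex of the core that belongs to every terminal cycle of the core. A *pendant neighbor* of $u$ is a vertex of degree one adjacent to $u$. **Statement.** Let $G$ be a simple partial 2-tree with a distinguished vertex $u$ that has precisely one pendant neighbor, say $v$. Then $M(G)=2$ if and only if $G-v$ is a graph of two parallel paths and $G-\{u,v\}$ is either a graph of two parallel paths or a path. -/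

import Mathlib

universe u

section MaximumMultiplicity

variable {V : Type u}

/-- `S(G)`: the real symmetric matrices whose graph is `G`; the diagonal is unrestricted. -/
def symMatrices (G : SimpleGraph V) : Set (Matrix V V ℝ) :=
  {A | A.IsSymm ∧ ∀ i j, i ≠ j → (A i j ≠ 0 ↔ G.Adj i j)}

/-- `M(A)`: the largest multiplicity of a real eigenvalue of `A`. For a real symmetric matrix,
algebraic and geometric multiplicities agree, so the dimension of the eigenspace is used. The
set below is bounded by the number of vertices. -/
noncomputable def maxEigenMult [Fintype V] [DecidableEq V] (A : Matrix V V ℝ) : ℕ :=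
  sSup {k | ∃ μ : ℝ, k = Module.finrank ℝ (Module.End.eigenspace (Matrix.toLin' A) μ)}

/-- `M(G)`: the maximum of `M(A)` over all `A ∈ S(G)`. -/
noncomputable def maxMult [Fintype V] [DecidableEq V] (G : SimpleGraph V) : ℕ :=
  sSup (maxEigenMult '' symMatrices G)

end MaximumMultiplicity

section ParallelPaths

variable {V : Type u}

/-- `G` is a path on `n ≥ 1` vertices. -/
def IsPathGraph (G : SimpleGraph V) : Prop :=
  ∃ n : ℕ, 1 ≤ n ∧ Nonempty (G ≃g SimpleGraph.pathGraph n)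

/-- `G` is a graph of two parallel paths: it is not itself a path, and there are two
vertex-disjoint nonempty induced paths `p` and `q` that cover all the vertices and can be
numbered consecutively in such a way that no two edges between them cross. -/
def IsTwoParallelPaths (G : SimpleGraph V) : Prop :=
  ¬ IsPathGraph G ∧
    ∃ (k l : ℕ) (p : SimpleGraph.pathGraph k ↪g G) (q : SimpleGraph.pathGraph l ↪g G),
      1 ≤ k ∧ 1 ≤ l ∧
      Disjoint (Set.range p) (Set.range q) ∧
      Set.range p ∪ Set.range q = Set.univ ∧
      ∀ (i i' : Fin k) (j j' : Fin l),
        i < i' → G.Adj (p i) (q j) → G.Adj (p i') (q j') → j ≤ j'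

end ParallelPaths

section PartialTrees

variable {V : Type u}

/-- The subgraph of `G` induced by the vertex set `S` is a `k`-tree: it is built from a
`(k+1)`-clique by successively articulating `(k+1)`-cliques along existing `k`-cliques, that is,
by adding a new vertex `w` whose earlier neighbours are exactly the members of a `k`-clique. -/
inductive IsKTreeOn (G : SimpleGraph V) (k : ℕ) : Set V → Prop
  | clique (K : Finset V) : G.IsNClique (k + 1) K → IsKTreeOn G k (K : Set V)
  | articulate (S : Set V) (K : Finset V) (w : V) :
      IsKTreeOn G k S → (K : Set V) ⊆ S → G.IsNClique k K → w ∉ S →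
      (∀ x ∈ S, G.Adj w x ↔ x ∈ K) → IsKTreeOn G k (insert w S)

/-- A `k`-tree. -/
def IsKTree (k : ℕ) (G : SimpleGraph V) : Prop :=
  IsKTreeOn G k Set.univ

/-- A partial `k`-tree: some edges (and no vertices) of a `k`-tree have been deleted. -/
def IsPartialKTree (k : ℕ) (G : SimpleGraph V) : Prop :=
  ∃ H : SimpleGraph V, IsKTree k H ∧ G ≤ H

end PartialTrees

section Core

variable {V : Type u}

/-- A `C₂` graph: connected, and no vertex has degree less than two. -/
def IsC2 (G : SimpleGraph V) : Prop :=
  G.Connected ∧ ∀ x, 2 ≤ (G.neighborSet x).encard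

/-- `C` is the vertex set of the core of `G`, the maximal induced `C₂` subgraph. -/
def IsCore (G : SimpleGraph V) (C : Set V) : Prop :=
  Maximal (fun S : Set V => IsC2 (G.induce S)) C

end Core

section ArticulatedCycles

variable {V : Type u}

/-- The vertex set `Z` induces a cycle in `G`. -/
def IsInducedCycle (G : SimpleGraph V) (Z : Set V) : Prop :=
  ∃ n : ℕ, 3 ≤ n ∧ Nonempty (G.induce Z ≃g SimpleGraph.cycleGraph n)

/-- `IsSEACOn G S 𝒵 E`: the subgraph of `G` induced by `S` is a singly edge-articulated cycle
graph. It is built from cycles, whose vertex sets form `𝒵`, by articulating each successive cycle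
along an edge of the graph built before; the set of edges of articulation is `E`, and no edge is
used more than once. Every constituent cycle is induced, and two of them have different vertex
sets, so that cycles are given by their vertex sets. -/
inductive IsSEACOn (G : SimpleGraph V) : Set V → Set (Set V) → Set (Sym2 V) → Prop
  | cycle (Z : Set V) : IsInducedCycle G Z → IsSEACOn G Z {Z} ∅
  | articulate (S : Set V) (𝒵 : Set (Set V)) (E : Set (Sym2 V)) (Z : Set V) (a b : V) :
      IsSEACOn G S 𝒵 E → IsInducedCycle G Z → G.Adj a b → S ∩ Z = {a, b} → s(a, b) ∉ E →
      (∀ x ∈ S \ Z, ∀ y ∈ Z \ S, ¬ G.Adj x y) →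
      IsSEACOn G (S ∪ Z) (insert Z 𝒵) (insert s(a, b) E)

/-- The neighbours of the constituent cycle `Z`: the other constituent cycles that share an edge
of articulation with it. -/
def cycleNeighbors (𝒵 : Set (Set V)) (E : Set (Sym2 V)) (Z : Set V) : Set (Set V) :=
  {Z' | Z' ∈ 𝒵 ∧ Z' ≠ Z ∧ ∃ e ∈ E, ∀ x ∈ e, x ∈ Z ∧ x ∈ Z'}

/-- The subgraph of `G` induced by `S` is a linear `SEAC` graph with constituent cycles `𝒵` and
edges of articulation `E`: each constituent cycle has at most two neighbours. -/
def IsLSEACOn (G : SimpleGraph V) (S : Set V) (𝒵 : Set (Set V)) (E : Set (Sym2 V)) : Prop :=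
  IsSEACOn G S 𝒵 E ∧ ∀ Z ∈ 𝒵, (cycleNeighbors 𝒵 E Z).encard ≤ 2

/-- A terminal cycle: a constituent cycle with at most one neighbour. -/
def IsTerminalCycle (𝒵 : Set (Set V)) (E : Set (Sym2 V)) (Z : Set V) : Prop :=
  Z ∈ 𝒵 ∧ (cycleNeighbors 𝒵 E Z).encard ≤ 1

/-- A simple partial 2-tree: a connected partial 2-tree whose core is an `LSEAC` graph (in
particular nonempty) and which is obtained from its core by attaching vertices of degree one to
vertices of the core. -/
def IsSimplePartialTwoTree (G : SimpleGraph V) : Prop :=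
  G.Connected ∧ IsPartialKTree 2 G ∧
    ∃ C : Set V, IsCore G C ∧ (∃ 𝒵 E, IsLSEACOn G C 𝒵 E) ∧
      ∀ w, w ∉ C → ∃ x ∈ C, G.neighborSet w = {x}

/-- A distinguished vertex: the core of `G` is an `LSEAC` graph and `x` is a vertex of the core
that belongs to each of its terminal cycles. -/
def IsDistinguished (G : SimpleGraph V) (x : V) : Prop :=
  ∃ (C : Set V) (𝒵 : Set (Set V)) (E : Set (Sym2 V)),
    IsCore G C ∧ IsLSEACOn G C 𝒵 E ∧ x ∈ C ∧ ∀ Z, IsTerminalCycle 𝒵 E Z → x ∈ Z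

/-- `w` is a pendant neighbour of `x`: a vertex of degree one that is adjacent to `x`. -/
def IsPendantNeighbor (G : SimpleGraph V) (x w : V) : Prop :=
  G.Adj x w ∧ (G.neighborSet w).encard = 1

end ArticulatedCycles

/-!
The cycles of the core form a chain, and a vertex `u` common to all terminal cycles lies on every
edge of articulation. Hence the core is a fan: an induced path `w 0, …, w N` and the vertex `u`,
which is adjacent to both ends of the path and possibly to some inner vertices
(`IsSEACOn.exists_isFan`). The graph `G` is this fan with pendant vertices, of which only `v` is
attached to `u` (`IsSimplePartialTwoTree.exists_isPendantFan`).

*Upper bound.* In the equations for an eigenvector the pendant vertex `v` can be eliminated. If its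
diagonal entry is the eigenvalue, then the eigenvector vanishes at `u` and restricts to a null
vector on `G - {u, v}`; otherwise it restricts to a null vector on `G - v`, with another diagonal
entry at `u` (`maxMult_le_two_of_pendant`). In a graph of two parallel paths a null vector is
determined by its entries at the first vertices of the two paths, as these form a zero forcing set
(`eq_zero_of_parallel`). So the multiplicity is at most two.

*Lower bound.* Matrices of `S(G)` with a large null space are Gram matrices of few vectors, changed
in the rows and columns of a few deleted vertices (`card_le_maxMult_add`). The vectors belong to the
edges of the tree `G - {u, v}` and to the edge `v u`: each is `e x - e y` for an edge `x y`, plus,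
on the path, a multiple of `e u`. The multiples can be chosen so that the entries between `u` and
the path vanish exactly where they should, provided that no interval between deleted vertices holds
exactly one neighbour of `u`
(`exists_balanced`, `IsPendantFan.le_maxMult_of_balanced`). Deleting nothing gives multiplicity at
least two. Deleting `u` and at most two path vertices, or at most three path vertices without `u`,
gives three unless the pendant vertices and the inner neighbours of `u` are placed in a few
specific ways (`exists_separation`). In each of these, two parallel paths can be written down:
for `G - {u, v}` a lower and an upper part of the path, for `G - v` an interval of the path and
the remainder, which is joined through `u`.
-/

/-! ### Multiplicity bounds -/

theorem finrank_eigenspace_le_maxMult {V : Type u} [Fintype V] [DecidableEq V]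
    {G : SimpleGraph V} {A : Matrix V V ℝ} (hA : A ∈ symMatrices G) (μ : ℝ) :
    Module.finrank ℝ (Module.End.eigenspace (Matrix.toLin' A) μ) ≤ maxMult G := by
  have hb : ∀ B : Matrix V V ℝ, ∀ k ∈ {k | ∃ μ : ℝ, k = Module.finrank ℝ
      (Module.End.eigenspace (Matrix.toLin' B) μ)}, k ≤ Fintype.card V := by
    rintro B k ⟨μ, rfl⟩
    simpa using Submodule.finrank_le (Module.End.eigenspace (Matrix.toLin' B) μ)
  refine le_trans (le_csSup ⟨_, hb A⟩ ⟨μ, rfl⟩) ?_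
  refine le_csSup (s := maxEigenMult '' symMatrices G) ⟨Fintype.card V, ?_⟩ ⟨A, hA, rfl⟩
  rintro _ ⟨B, -, rfl⟩
  exact csSup_le' (hb B)

theorem maxMult_le {V : Type u} [Fintype V] [DecidableEq V] {G : SimpleGraph V} {m : ℕ}
    (h : ∀ A ∈ symMatrices G, ∀ μ : ℝ,
      Module.finrank ℝ (Module.End.eigenspace (Matrix.toLin' A) μ) ≤ m) :
    maxMult G ≤ m := by
  refine csSup_le' ?_
  rintro _ ⟨A, hA, rfl⟩
  refine csSup_le' ?_
  rintro _ ⟨μ, rfl⟩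
  exact h A hA μ

/-- A matrix of `S(G)` can be assembled from a Gram matrix outside the rows and columns of `D` and
from arbitrary entries in those rows and columns. Its null space contains the vectors that are
orthogonal to the vectors `y x`, `x ∉ X`, of the Gram matrix, vanish on `D` and are annihilated by the rows
of `D`, whence the bound. -/
theorem card_le_maxMult_add {V : Type u} [Fintype V] [DecidableEq V] (G : SimpleGraph V)
    (X D : Finset V) (y : V → V → ℝ)
    (h : ∀ i j, i ≠ j → i ∉ D → j ∉ D → ((∑ x ∈ Xᶜ, y x i * y x j) ≠ 0 ↔ G.Adj i j)) :
    X.card ≤ maxMult G + 2 * D.card := by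
  classical
  let A : Matrix V V ℝ := fun i j =>
    if i ∈ D ∨ j ∈ D then (if G.Adj i j then 1 else 0) else ∑ x ∈ Xᶜ, y x i * y x j
  have hA : A ∈ symMatrices G := by
    constructor
    · refine Matrix.IsSymm.ext fun i j => ?_
      simp only [A, or_comm (a := j ∈ D), G.adj_comm j i, mul_comm (y _ j)]
    · intro i j hij
      simp only [A]
      split_ifs with h1 h2
      · simpa using h2
      · simpa using h2
      · push Not at h1
        exact h i j hij h1.1 h1.2
  let L : (V → ℝ) →ₗ[ℝ] ((Xᶜ : Finset V) → ℝ) × (D → ℝ) × (D → ℝ) :=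
    LinearMap.prod (LinearMap.pi fun x => ∑ i, y x i • LinearMap.proj i)
      (LinearMap.prod (LinearMap.pi fun d => LinearMap.proj (d : V))
        (LinearMap.pi fun d => (LinearMap.proj (d : V)).comp (Matrix.toLin' A)))
  have hL : LinearMap.ker L ≤ Module.End.eigenspace (Matrix.toLin' A) 0 := by
    intro z hz
    rw [LinearMap.mem_ker] at hz
    have h1 : ∀ x ∈ Xᶜ, ∑ i, y x i * z i = 0 := fun x hx => by
      simpa [L] using congrFun (congrArg Prod.fst hz) ⟨x, hx⟩
    have h2 : ∀ d ∈ D, z d = 0 := fun d hd => by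
      simpa [L] using congrFun (congrArg (fun t => t.2.1) hz) ⟨d, hd⟩
    have h3 : ∀ d ∈ D, Matrix.toLin' A z d = 0 := fun d hd => by
      simpa [L] using congrFun (congrArg (fun t => t.2.2) hz) ⟨d, hd⟩
    rw [Module.End.mem_eigenspace_iff, zero_smul]
    ext i
    by_cases hi : i ∈ D
    · exact h3 i hi
    · rw [Matrix.toLin'_apply]
      have : ∀ j, A i j * z j = ∑ x ∈ Xᶜ, y x i * (y x j * z j) := by
        intro j
        by_cases hj : j ∈ D
        · simp [h2 j hj]
        · simp [A, hi, hj, Finset.sum_mul, mul_assoc]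
      simp only [Matrix.mulVec, dotProduct, this, Pi.zero_apply]
      rw [Finset.sum_comm]
      refine Finset.sum_eq_zero fun x hx => ?_
      rw [← Finset.mul_sum, h1 x hx, mul_zero]
  have hle := (Submodule.finrank_mono hL).trans (finrank_eigenspace_le_maxMult hA 0)
  have hrn := LinearMap.finrank_range_add_finrank_ker L
  have hr := Submodule.finrank_le (LinearMap.range L)
  simp only [Module.finrank_prod, Module.finrank_pi, Fintype.card_coe] at hr hrn
  have := Finset.card_add_card_compl X
  omega

/-- Two vertices whose coordinates determine every null vector of every matrix of `S(H)`, as a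
zero forcing set of two vertices does. -/
def IsForcedByTwo {W : Type u} [Fintype W] (H : SimpleGraph W) : Prop :=
  ∃ a b : W, ∀ B ∈ symMatrices H, ∀ x : W → ℝ, B.mulVec x = 0 → x a = 0 → x b = 0 → x = 0

/-- The first vertices of two parallel paths force all the others: if `p` has been forced up to
`p (a - 1)` and `q` up to `q (b - 1)`, then either `p (a - 1)` forces `p a` or `q (b - 1)` forces
`q b`, since otherwise two edges between the paths would cross. -/
theorem eq_zero_of_parallel {W : Type u} [Fintype W] {H : SimpleGraph W} {k l : ℕ}
    (p : SimpleGraph.pathGraph k ↪g H) (q : SimpleGraph.pathGraph l ↪g H)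
    (hpq : Set.range p ∪ Set.range q = Set.univ)
    (hc : ∀ (i i' : Fin k) (j j' : Fin l),
      i < i' → H.Adj (p i) (q j) → H.Adj (p i') (q j') → j ≤ j')
    {B : Matrix W W ℝ} (hB : B ∈ symMatrices H) {x : W → ℝ} (hx : B.mulVec x = 0)
    (hp0 : ∀ i : Fin k, i.val = 0 → x (p i) = 0) (hq0 : ∀ j : Fin l, j.val = 0 → x (q j) = 0) :
    x = 0 := by
  classical
  have hcov : ∀ y, (∃ i, p i = y) ∨ ∃ j, q j = y := fun y => by
    have : y ∈ Set.range p ∪ Set.range q := hpq ▸ Set.mem_univ y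
    simpa using this
  -- a vertex all of whose neighbours but one carry zeros forces the last one
  have force : ∀ y z, H.Adj y z → x y = 0 → (∀ t, H.Adj y t → t ≠ z → x t = 0) → x z = 0 := by
    intro y z hyz hy ht
    have h1 : ∑ t, B y t * x t = 0 := congrFun hx y
    rw [Finset.sum_eq_single z] at h1
    · exact (mul_eq_zero.1 h1).resolve_left ((hB.2 y z hyz.ne).2 hyz)
    · intro t _ htz
      by_cases hyt : t = y
      · rw [hyt, hy, mul_zero]
      · by_cases hadj : H.Adj y t
        · rw [ht t hadj htz, mul_zero]
        · rw [not_not.1 (fun h => hadj ((hB.2 y t (Ne.symm hyt)).1 h)), zero_mul]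
    · simp
  have key : ∀ m ≤ k + l, ∃ a b, a ≤ k ∧ b ≤ l ∧ a + b = m ∧
      (∀ i : Fin k, i.val < a → x (p i) = 0) ∧ (∀ j : Fin l, j.val < b → x (q j) = 0) := by
    intro m
    induction m with
    | zero => exact fun _ => ⟨0, 0, by simp⟩
    | succ m ih =>
      intro hm
      obtain ⟨a, b, ha, hb, hab, hpa, hqb⟩ := ih (by omega)
      have stepP : ∀ h : a < k, x (p ⟨a, h⟩) = 0 → ∃ a b, a ≤ k ∧ b ≤ l ∧ a + b = m + 1 ∧
          (∀ i : Fin k, i.val < a → x (p i) = 0) ∧ (∀ j : Fin l, j.val < b → x (q j) = 0) := by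
        refine fun h h0 => ⟨a + 1, b, h, hb, by omega, fun i hi => ?_, hqb⟩
        rcases Nat.lt_succ_iff_lt_or_eq.1 hi with hi | hi
        · exact hpa i hi
        · rwa [show i = ⟨a, h⟩ from Fin.ext hi]
      have stepQ : ∀ h : b < l, x (q ⟨b, h⟩) = 0 → ∃ a b, a ≤ k ∧ b ≤ l ∧ a + b = m + 1 ∧
          (∀ i : Fin k, i.val < a → x (p i) = 0) ∧ (∀ j : Fin l, j.val < b → x (q j) = 0) := by
        refine fun h h0 => ⟨a, b + 1, ha, h, by omega, hpa, fun i hi => ?_⟩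
        rcases Nat.lt_succ_iff_lt_or_eq.1 hi with hi | hi
        · exact hqb i hi
        · rwa [show i = ⟨b, h⟩ from Fin.ext hi]
      have blockP : ∀ h : a < k, x (p ⟨a, h⟩) = 0 ∨
          ∃ i : Fin k, ∃ j : Fin l, i.val + 1 = a ∧ b ≤ j.val ∧ H.Adj (p i) (q j) := by
        intro h
        by_cases ha0 : a = 0
        · exact Or.inl (hp0 _ ha0)
        by_contra! hcon
        refine hcon.1 (force (p ⟨a - 1, by omega⟩) _ ?_ (hpa _ (by simp; omega)) ?_)
        · rw [p.map_adj_iff, SimpleGraph.pathGraph_adj]; left; simp; omega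
        · intro t hadj hne
          rcases hcov t with ⟨i, rfl⟩ | ⟨j, rfl⟩
          · rw [p.map_adj_iff, SimpleGraph.pathGraph_adj] at hadj
            refine hpa i ?_
            have : i.val ≠ a := fun h => hne (congrArg p (Fin.ext h))
            simp at hadj; omega
          · exact hqb j (not_le.1 fun hj => hcon.2 ⟨a - 1, by omega⟩ j (by simp; omega) hj hadj)
      have blockQ : ∀ h : b < l, x (q ⟨b, h⟩) = 0 ∨
          ∃ i : Fin k, ∃ j : Fin l, j.val + 1 = b ∧ a ≤ i.val ∧ H.Adj (p i) (q j) := by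
        intro h
        by_cases ha0 : b = 0
        · exact Or.inl (hq0 _ ha0)
        by_contra! hcon
        refine hcon.1 (force (q ⟨b - 1, by omega⟩) _ ?_ (hqb _ (by simp; omega)) ?_)
        · rw [q.map_adj_iff, SimpleGraph.pathGraph_adj]; left; simp; omega
        · intro t hadj hne
          rcases hcov t with ⟨i, rfl⟩ | ⟨j, rfl⟩
          · exact hpa i (not_le.1 fun hj =>
              hcon.2 i ⟨b - 1, by omega⟩ (by simp; omega) hj hadj.symm)
          · rw [q.map_adj_iff, SimpleGraph.pathGraph_adj] at hadj
            refine hqb j ?_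
            have : j.val ≠ b := fun h => hne (congrArg q (Fin.ext h))
            simp at hadj; omega
      rcases lt_or_eq_of_le ha with ha' | ha'
      · rcases blockP ha' with h | ⟨i, j, hi, hj, hij⟩
        · exact stepP ha' h
        have hb' : b < l := lt_of_le_of_lt hj j.2
        rcases blockQ hb' with h | ⟨i', j', hj', hi', hij'⟩
        · exact stepQ hb' h
        have := hc i i' j j' (Fin.lt_def.2 (by omega)) hij hij'
        rw [Fin.le_def] at this
        omega
      · have hb' : b < l := by omega
        rcases blockQ hb' with h | ⟨i', j', hj', hi', hij'⟩
        · exact stepQ hb' h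
        · have := i'.2; omega
  obtain ⟨a, b, ha, hb, hab, hpa, hqb⟩ := key (k + l) le_rfl
  funext y
  rcases hcov y with ⟨i, rfl⟩ | ⟨j, rfl⟩
  · exact hpa i (by omega)
  · exact hqb j (by omega)

theorem IsTwoParallelPaths.isForcedByTwo {W : Type u} [Fintype W] {H : SimpleGraph W}
    (h : IsTwoParallelPaths H) : IsForcedByTwo H := by
  obtain ⟨-, k, l, p, q, hk, hl, -, hcov, hc⟩ := h
  refine ⟨p ⟨0, hk⟩, q ⟨0, hl⟩, fun B hB x hx h1 h2 =>
    eq_zero_of_parallel p q hcov hc hB hx (fun i hi => ?_) (fun i hi => ?_)⟩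
  · rwa [show i = ⟨0, hk⟩ from Fin.ext hi]
  · rwa [show i = ⟨0, hl⟩ from Fin.ext hi]

theorem IsPathGraph.isForcedByTwo {W : Type u} [Fintype W] {H : SimpleGraph W}
    (h : IsPathGraph H) : IsForcedByTwo H := by
  obtain ⟨n, hn, ⟨e⟩⟩ := h
  let q : SimpleGraph.pathGraph 0 ↪g H :=
    { toFun := fun i => i.elim0, inj' := fun i => i.elim0, map_rel_iff' := fun {i} => i.elim0 }
  refine ⟨e.symm ⟨0, hn⟩, e.symm ⟨0, hn⟩, fun B hB x hx h1 _ =>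
    eq_zero_of_parallel e.symm.toEmbedding q ?_ (fun _ _ j => j.elim0) hB hx (fun i hi => ?_)
      (fun i => i.elim0)⟩
  · have : Set.range e.symm.toEmbedding = Set.univ := e.symm.surjective.range_eq
    rw [this, Set.univ_union]
  · rw [show i = ⟨0, hn⟩ from Fin.ext hi]; exact h1

/-- The pendant vertex `v` at `u` is eliminated from the eigenvalue equations: if its diagonal
entry is the eigenvalue, an eigenvector vanishes at `u` and restricts to `G - {u, v}`; otherwise
it restricts to `G - v`, with the diagonal entry at `u` changed. -/
theorem maxMult_le_two_of_pendant {V : Type u} [Fintype V] [DecidableEq V] {G : SimpleGraph V}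
    {u v : V} (hv : ∀ y, G.Adj v y ↔ y = u)
    (h1 : IsForcedByTwo (G.induce ({v}ᶜ : Set V)))
    (h2 : IsForcedByTwo (G.induce ({u, v}ᶜ : Set V))) : maxMult G ≤ 2 := by
  have huv : u ≠ v := fun h => G.irrefl (h ▸ (hv u).2 rfl : G.Adj u u)
  refine maxMult_le fun A hA μ => ?_
  have hzero : ∀ i j, i ≠ j → ¬ G.Adj i j → A i j = 0 := fun i j hij h =>
    not_not.1 fun h' => h ((hA.2 i j hij).1 h')
  have hvu : A v u ≠ 0 := (hA.2 v u huv.symm).2 ((hv u).2 rfl)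
  have hsymm : ∀ i j, A i j = A j i := fun i j => by rw [← Matrix.IsSymm.apply hA.1]
  have hrow : ∀ x ∈ Module.End.eigenspace (Matrix.toLin' A) μ, ∀ i,
      ∑ j, A i j * x j = μ * x i := fun x hx i => by
    have := congrFun (Module.End.mem_eigenspace_iff.1 hx) i
    simpa [Matrix.toLin'_apply, Matrix.mulVec, dotProduct] using this
  have hrowv : ∀ x ∈ Module.End.eigenspace (Matrix.toLin' A) μ,
      A v u * x u + A v v * x v = μ * x v := fun x hx => by
    rw [← hrow x hx v, Finset.sum_eq_add u v huv]
    · intro j _ hj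
      rw [hzero v j hj.2.symm (fun h => hj.1 ((hv j).1 h)), zero_mul]
    · simp
    · simp
  suffices h : ∃ a b : V, ∀ x ∈ Module.End.eigenspace (Matrix.toLin' A) μ,
      x a = 0 → x b = 0 → x = 0 by
    obtain ⟨a, b, hab⟩ := h
    let L : Module.End.eigenspace (Matrix.toLin' A) μ →ₗ[ℝ] ℝ × ℝ :=
      ((LinearMap.proj a).prod (LinearMap.proj b)).comp (Submodule.subtype _)
    have hL : Function.Injective L := by
      rw [← LinearMap.ker_eq_bot, LinearMap.ker_eq_bot']
      intro x hx
      have hx' : (x.1 a, x.1 b) = ((0 : ℝ), (0 : ℝ)) := hx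
      rw [Prod.mk.injEq] at hx'
      exact Subtype.ext (hab x.1 x.2 hx'.1 hx'.2)
    simpa using LinearMap.finrank_le_finrank_of_injective hL
  by_cases hμ : A v v = μ
  · obtain ⟨a, b, hab⟩ := h2
    refine ⟨a, b, fun x hx ha hb => ?_⟩
    have hxu : x u = 0 := by
      have := hrowv x hx
      rw [hμ] at this
      simpa [hvu] using this
    let B : Matrix ({u, v}ᶜ : Set V) ({u, v}ᶜ : Set V) ℝ :=
      fun i j => A i j - if i = j then μ else 0
    have hB : B ∈ symMatrices (G.induce ({u, v}ᶜ : Set V)) := by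
      constructor
      · refine Matrix.IsSymm.ext fun i j => ?_
        simp only [B, hsymm j i, eq_comm]
      · intro i j hij
        simp only [B, if_neg hij, sub_zero, SimpleGraph.comap_adj, Function.Embedding.subtype_apply]
        exact hA.2 i j (fun h => hij (Subtype.ext h))
    have hx0 := hab B hB (fun i => x i) (by
      funext i
      have hi : (i : V) ≠ u ∧ (i : V) ≠ v := by
        have := i.2
        rwa [Set.mem_compl_iff, Set.mem_insert_iff, Set.mem_singleton_iff, not_or] at this
      have hs := hrow x hx i
      have : ∑ j : ({u, v}ᶜ : Set V), A i j * x j = ∑ j, A i j * x j := by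
        rw [Finset.sum_set_coe ({u, v}ᶜ : Set V) (f := fun j => A i j * x j)]
        refine Finset.sum_subset (Finset.subset_univ _) fun j _ hj => ?_
        rw [Set.mem_toFinset, Set.mem_compl_iff, not_not, Set.mem_insert_iff,
          Set.mem_singleton_iff] at hj
        rcases hj with rfl | rfl
        · rw [hxu, mul_zero]
        · rw [hzero i j hi.2 (fun h => hi.1 ((hv i).1 h.symm)), zero_mul]
      simp only [Matrix.mulVec, dotProduct, B, sub_mul, Finset.sum_sub_distrib, this, hs]
      simp) ha hb
    have hxT : ∀ i, i ≠ u → i ≠ v → x i = 0 := fun i h1 h2 =>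
      congrFun hx0 ⟨i, by simp [h1, h2]⟩
    have hxv : x v = 0 := by
      have := hrow x hx u
      rw [Finset.sum_eq_single v] at this
      · rw [hxu, mul_zero, hsymm] at this
        exact (mul_eq_zero.1 this).resolve_left hvu
      · intro j _ hj
        by_cases hju : j = u
        · rw [hju, hxu, mul_zero]
        · rw [hxT j hju hj, mul_zero]
      · simp
    funext i
    by_cases hi : i = u
    · rw [hi, hxu]; rfl
    by_cases hi' : i = v
    · rw [hi', hxv]; rfl
    exact hxT i hi hi'
  · obtain ⟨a, b, hab⟩ := h1
    refine ⟨a, b, fun x hx ha hb => ?_⟩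
    have hμ' : μ - A v v ≠ 0 := sub_ne_zero.2 (Ne.symm hμ)
    have hxv : x v = A v u / (μ - A v v) * x u := by
      have := hrowv x hx
      field_simp
      linarith
    let B : Matrix ({v}ᶜ : Set V) ({v}ᶜ : Set V) ℝ :=
      fun i j => A i j - if i = j then (μ - A i v * (A v u / (μ - A v v))) else 0
    have hB : B ∈ symMatrices (G.induce ({v}ᶜ : Set V)) := by
      constructor
      · refine Matrix.IsSymm.ext fun i j => ?_
        by_cases hij : i = j
        · rw [hij]
        · simp only [B, hsymm j i, if_neg hij, if_neg (Ne.symm hij)]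
      · intro i j hij
        simp only [B, if_neg hij, sub_zero, SimpleGraph.comap_adj, Function.Embedding.subtype_apply]
        exact hA.2 i j (fun h => hij (Subtype.ext h))
    have hx0 := hab B hB (fun i => x i) (by
      funext i
      have hi : (i : V) ≠ v := i.2
      have hs := hrow x hx i
      have : ∑ j : ({v}ᶜ : Set V), A i j * x j + A i v * x v = ∑ j, A i j * x j := by
        rw [Finset.sum_set_coe ({v}ᶜ : Set V) (f := fun j => A i j * x j),
          Fintype.sum_eq_sum_compl_add v]
        congr 2
        ext j
        simp
      have hiu : A i v * x u = A i v * x i := by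
        by_cases hiu : (i : V) = u
        · rw [hiu]
        · rw [hzero i v hi (fun h => hiu ((hv i).1 h.symm))]; simp
      have hxv' : A i v * x v = A i v * (A v u / (μ - A v v)) * x i := by
        rw [hxv]; linear_combination (A v u / (μ - A v v)) * hiu
      simp only [Matrix.mulVec, dotProduct, B, sub_mul, Finset.sum_sub_distrib,
        eq_sub_of_add_eq this, hs, hxv']
      simp [sub_mul]) ha hb
    have hxT : ∀ i, i ≠ v → x i = 0 := fun i h1 => congrFun hx0 ⟨i, by simp [h1]⟩
    funext i
    by_cases hi' : i = v
    · rw [hi', hxv, hxT u huv, mul_zero]; rfl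
    exact hxT i hi'

/-! ### Cores with a distinguished vertex are fans -/

/-- The subgraph of `G` induced by `S` is a fan with centre `u`: an induced path `w 0, …, w N`
together with a vertex `u` that is adjacent to both ends of the path, and possibly to some of its
inner vertices. The values of `w` beyond `N` play no role. -/
structure IsFan {V : Type u} (G : SimpleGraph V) (u : V) (S : Set V) (N : ℕ) (w : ℕ → V) :
    Prop where
  one_le : 1 ≤ N
  mem_iff : ∀ x, x ∈ S ↔ x = u ∨ ∃ i ≤ N, x = w i
  ne_center : ∀ i ≤ N, w i ≠ u
  inj : ∀ i ≤ N, ∀ j ≤ N, w i = w j → i = j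
  adj_iff : ∀ i ≤ N, ∀ j ≤ N, G.Adj (w i) (w j) ↔ i + 1 = j ∨ j + 1 = i
  adj_zero : G.Adj u (w 0)
  adj_last : G.Adj u (w N)

namespace IsFan

variable {V : Type u} {G : SimpleGraph V} {u : V} {S Z : Set V} {N M : ℕ} {w z : ℕ → V}

theorem center_mem (h : IsFan G u S N w) : u ∈ S := (h.mem_iff u).2 (Or.inl rfl)

theorem mem (h : IsFan G u S N w) {i : ℕ} (hi : i ≤ N) : w i ∈ S :=
  (h.mem_iff _).2 (Or.inr ⟨i, hi, rfl⟩)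

theorem reverse (h : IsFan G u S N w) : IsFan G u S N (fun i => w (N - i)) where
  one_le := h.one_le
  mem_iff x := by
    rw [h.mem_iff]
    refine or_congr Iff.rfl ⟨?_, ?_⟩
    · rintro ⟨i, hi, rfl⟩
      exact ⟨N - i, by omega, by rw [Nat.sub_sub_self hi]⟩
    · rintro ⟨i, hi, rfl⟩
      exact ⟨N - i, by omega, rfl⟩
  ne_center i _ := h.ne_center _ (by omega)
  inj i hi j hj hij := by
    have := h.inj _ (by omega) _ (by omega) hij
    omega
  adj_iff i hi j hj := by
    rw [h.adj_iff _ (by omega) _ (by omega)]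
    omega
  adj_zero := by simpa using h.adj_last
  adj_last := by simpa using h.adj_zero

/-- Two fans with the same centre `u` are joined along an edge between `u` and an end of each of
the two paths. -/
theorem append (h : IsFan G u S N w) (h' : IsFan G u Z M z) (hSZ : S ∩ Z = {u, w N})
    (hz : z 0 = w N) (hn : ∀ x ∈ S \ Z, ∀ y ∈ Z \ S, ¬ G.Adj x y) :
    IsFan G u (S ∪ Z) (N + M) (fun i => if i ≤ N then w i else z (i - N)) := by
  have hzS : ∀ j, 1 ≤ j → j ≤ M → z j ∈ Z \ S := fun j h1 h2 => by
    refine ⟨h'.mem h2, fun hS => ?_⟩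
    have : z j ∈ S ∩ Z := ⟨hS, h'.mem h2⟩
    rw [hSZ] at this
    rcases this with h3 | h3
    · exact h'.ne_center j h2 h3
    · have := h'.inj j h2 0 (by omega) (by rw [hz]; exact h3)
      omega
  have hwZ : ∀ i, i < N → w i ∈ S \ Z := fun i hi => by
    refine ⟨h.mem hi.le, fun hZ => ?_⟩
    have : w i ∈ S ∩ Z := ⟨h.mem hi.le, hZ⟩
    rw [hSZ] at this
    rcases this with h3 | h3
    · exact h.ne_center i hi.le h3
    · have := h.inj i hi.le N le_rfl h3
      omega
  have hcross : ∀ i j, i ≤ N → 1 ≤ j → j ≤ M → (G.Adj (w i) (z j) ↔ i = N ∧ j = 1) := by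
    intro i j hi hj hj'
    rcases lt_or_eq_of_le hi with hi' | rfl
    · exact iff_of_false (hn _ (hwZ i hi') _ (hzS j hj hj')) (by omega)
    · rw [← hz, h'.adj_iff 0 (by omega) j hj']
      omega
  refine ⟨by have := h.one_le; omega, fun x => ?_, fun i hi => ?_, fun i hi j hj hij => ?_,
    fun i hi j hj => ?_, by simpa using h.adj_zero, ?_⟩
  · rw [Set.mem_union, h.mem_iff, h'.mem_iff]
    constructor
    · rintro ((rfl | ⟨i, hi, rfl⟩) | (rfl | ⟨i, hi, rfl⟩))
      · exact Or.inl rfl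
      · exact Or.inr ⟨i, by omega, by simp [hi]⟩
      · exact Or.inl rfl
      · refine Or.inr ⟨N + i, by omega, ?_⟩
        by_cases h0 : i = 0
        · simp [h0, hz]
        · simp [h0]
    · rintro (rfl | ⟨i, hi, rfl⟩)
      · simp
      · split_ifs with h1
        · exact Or.inl (Or.inr ⟨i, h1, rfl⟩)
        · exact Or.inr (Or.inr ⟨i - N, by omega, rfl⟩)
  · split_ifs with h1
    · exact h.ne_center i h1
    · exact h'.ne_center _ (by omega)
  · split_ifs at hij with h1 h2 h2
    · exact h.inj i h1 j h2 hij
    · exact absurd (h.mem h1) (hij ▸ (hzS (j - N) (by omega) (by omega)).2)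
    · exact absurd (h.mem h2) (hij ▸ (hzS (i - N) (by omega) (by omega)).2)
    · have := h'.inj _ (by omega) _ (by omega) hij
      omega
  · split_ifs with h1 h2 h2
    · exact h.adj_iff i h1 j h2
    · rw [hcross i (j - N) h1 (by omega) (by omega)]
      omega
    · rw [G.adj_comm, hcross j (i - N) h2 (by omega) (by omega)]
      omega
    · rw [h'.adj_iff _ (by omega) _ (by omega)]
      omega
  · have := h'.one_le
    simpa [show ¬ N + M ≤ N by omega] using h'.adj_last

end IsFan

/-- An induced cycle is a fan without inner chords, centred at any of its vertices. -/
theorem IsInducedCycle.exists_isFan {V : Type u} {G : SimpleGraph V} {u : V} {Z : Set V}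
    (h : IsInducedCycle G Z) (hu : u ∈ Z) :
    ∃ N w, IsFan G u Z N w ∧ ∀ k, 0 < k → k < N → ¬ G.Adj u (w k) := by
  obtain ⟨n, hn, ⟨e⟩⟩ := h
  obtain ⟨m, rfl⟩ : ∃ m, n = m + 3 := ⟨n - 3, by omega⟩
  set c : Fin (m + 3) := e ⟨u, hu⟩ with hc
  have hadj : ∀ a b : Fin (m + 3), G.Adj (e.symm a : V) (e.symm b) ↔ a = b + 1 ∨ b = a + 1 := by
    intro a b
    have h1 : (G.induce Z).Adj (e.symm a) (e.symm b) ↔ _ := e.symm.map_adj_iff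
    rw [SimpleGraph.cycleGraph_adj, sub_eq_iff_eq_add, sub_eq_iff_eq_add, add_comm 1,
      add_comm 1] at h1
    exact h1
  let s : ℕ → Fin (m + 3) := fun i => Fin.ofNat (m + 3) i
  have hs1 : ∀ i, s i + 1 = s (i + 1) := fun i => by
    apply Fin.ext
    simp [s, Fin.val_add]
  have hs : ∀ i j, i < m + 3 → j ≤ m + 3 → (s i = s j ↔ i = j ∨ (i = 0 ∧ j = m + 3)) := by
    intro i j hi hj
    rw [Fin.ext_iff]
    simp only [s, Fin.ofNat_eq_cast, Fin.val_natCast]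
    rcases lt_or_eq_of_le hj with hj | rfl
    · rw [Nat.mod_eq_of_lt hi, Nat.mod_eq_of_lt hj]; omega
    · rw [Nat.mod_eq_of_lt hi, Nat.mod_self]; omega
  have hadj' : ∀ i j, G.Adj (e.symm (c + s i) : V) (e.symm (c + s j)) ↔
      s i = s (j + 1) ∨ s j = s (i + 1) := by
    intro i j
    rw [hadj, add_assoc, add_assoc, hs1, hs1, add_right_inj, add_right_inj]
  have hu' : (e.symm (c + s 0) : V) = u := by
    have : s 0 = 0 := rfl
    rw [this, add_zero, hc, e.symm_apply_apply]
  have hinj : ∀ i j, (e.symm (c + s i) : V) = e.symm (c + s j) → s i = s j := fun i j h =>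
    add_left_cancel (e.symm.injective (Subtype.ext h))
  have hu'' : ∀ j, G.Adj u (e.symm (c + s j) : V) ↔ s 0 = s (j + 1) ∨ s j = s (0 + 1) := by
    intro j
    rw [← hadj', hu']
  refine ⟨m + 1, fun i => e.symm (c + s (i + 1)), ⟨by omega, fun x => ⟨fun hx => ?_, ?_⟩,
    fun i hi h => ?_, fun i hi j hj h => ?_, fun i hi j hj => ?_, ?_, ?_⟩, fun k h1 h2 => ?_⟩
  · by_cases h0 : x = u
    · exact Or.inl h0
    have hd : e ⟨x, hx⟩ - c ≠ 0 := fun h => h0 (by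
      have := e.injective (sub_eq_zero.1 h)
      exact congrArg Subtype.val this)
    have hd' : (e ⟨x, hx⟩ - c).val ≠ 0 := fun h => hd (Fin.ext h)
    refine Or.inr ⟨(e ⟨x, hx⟩ - c).val - 1, by omega, ?_⟩
    have : s ((e ⟨x, hx⟩ - c).val - 1 + 1) = e ⟨x, hx⟩ - c := by
      apply Fin.ext
      simp only [s, Fin.ofNat_eq_cast, Fin.val_natCast]
      rw [Nat.sub_add_cancel (by omega), Nat.mod_eq_of_lt (Fin.is_lt _)]
    rw [this, add_sub_cancel, e.symm_apply_apply]
  · rintro (rfl | ⟨i, -, rfl⟩)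
    · exact hu
    · exact Subtype.prop _
  · have := (hs (i + 1) 0 (by omega) (by omega)).1 (hinj _ _ (h.trans hu'.symm))
    omega
  · have := (hs (i + 1) (j + 1) (by omega) (by omega)).1 (hinj _ _ h)
    omega
  · rw [hadj', hs _ _ (by omega) (by omega), hs _ _ (by omega) (by omega)]
    omega
  · rw [hu'', hs _ _ (by omega) (by omega), hs _ _ (by omega) (by omega)]
    omega
  · rw [hu'', hs _ _ (by omega) (by omega), hs _ _ (by omega) (by omega)]
    omega
  · rw [hu'', hs _ _ (by omega) (by omega), hs _ _ (by omega) (by omega)]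
    omega

namespace IsSEACOn

variable {V : Type u} {G : SimpleGraph V} {S : Set V} {𝒵 : Set (Set V)} {E : Set (Sym2 V)}

theorem subset (h : IsSEACOn G S 𝒵 E) : ∀ Y ∈ 𝒵, Y ⊆ S := by
  induction h with
  | cycle Z hZ => rintro Y rfl; exact subset_rfl
  | articulate S 𝒵 E Z a b _ _ _ _ _ _ ih =>
    rintro Y (rfl | hY)
    · exact Set.subset_union_right
    · exact (ih Y hY).trans Set.subset_union_left

theorem exists_cycle_of_adj (h : IsSEACOn G S 𝒵 E) :
    ∀ x ∈ S, ∀ y ∈ S, G.Adj x y → ∃ Y ∈ 𝒵, x ∈ Y ∧ y ∈ Y := by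
  induction h with
  | cycle Z hZ => exact fun x hx y hy _ => ⟨Z, rfl, hx, hy⟩
  | articulate S 𝒵 E Z a b _ _ _ _ _ hn ih =>
    intro x hx y hy hxy
    by_cases hS : x ∈ S ∧ y ∈ S
    · obtain ⟨Y, hY, h⟩ := ih x hS.1 y hS.2 hxy
      exact ⟨Y, Or.inr hY, h⟩
    by_cases hZ : x ∈ Z ∧ y ∈ Z
    · exact ⟨Z, Or.inl rfl, hZ⟩
    have h1 := hn x
    have h2 := hn y
    simp only [Set.mem_union, Set.mem_sdiff] at *
    by_cases hxS : x ∈ S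
    · exact absurd hxy (h1 ⟨hxS, by tauto⟩ y (by tauto))
    · exact absurd hxy.symm (h2 (by tauto) x (by tauto))

/-- Two constituent cycles share at most an edge of articulation. -/
theorem mem_of_two_cycles (h : IsSEACOn G S 𝒵 E) :
    ∀ Y ∈ 𝒵, ∀ Y' ∈ 𝒵, Y ≠ Y' → ∀ x y, x ≠ y → x ∈ Y → y ∈ Y → x ∈ Y' → y ∈ Y' →
      s(x, y) ∈ E := by
  induction h with
  | cycle Z hZ => rintro Y rfl Y' rfl h; exact absurd rfl h
  | articulate S 𝒵 E Z a b hS _ _ hSZ _ _ ih =>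
    have key : ∀ Y ∈ 𝒵, ∀ x y, x ≠ y → x ∈ Y → y ∈ Y → x ∈ Z → y ∈ Z →
        s(x, y) ∈ insert s(a, b) E := by
      intro Y hY x y hxy hx hy hx' hy'
      have h1 : x ∈ S ∩ Z := ⟨hS.subset Y hY hx, hx'⟩
      have h2 : y ∈ S ∩ Z := ⟨hS.subset Y hY hy, hy'⟩
      rw [hSZ] at h1 h2
      left
      rcases h1 with rfl | rfl <;> rcases h2 with rfl | rfl
      · exact absurd rfl hxy
      · rfl
      · exact Sym2.eq_swap
      · exact absurd rfl hxy
    rintro Y (rfl | hY) Y' (rfl | hY') hne x y hxy h1 h2 h3 h4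
    · exact absurd rfl hne
    · exact key Y' hY' x y hxy h3 h4 h1 h2
    · exact key Y hY x y hxy h1 h2 h3 h4
    · exact Or.inr (ih Y hY Y' hY' hne x y hxy h1 h2 h3 h4)

theorem edges_subset (h : IsSEACOn G S 𝒵 E) : E ⊆ G.edgeSet := by
  induction h with
  | cycle Z hZ => exact Set.empty_subset _
  | articulate S 𝒵 E Z a b _ _ hab _ _ _ ih =>
    rintro e (rfl | he)
    · exact hab
    · exact ih he

end IsSEACOn

theorem IsInducedCycle.exists_third {V : Type u} {G : SimpleGraph V} {Z : Set V}
    (h : IsInducedCycle G Z) (a b : V) : ∃ x ∈ Z, x ≠ a ∧ x ≠ b := by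
  obtain ⟨n, hn, ⟨e⟩⟩ := h
  by_contra! hcon
  have hsub : Z ⊆ {a, b} := fun x hx => by
    by_cases hxa : x = a
    · exact Or.inl hxa
    · exact Or.inr (hcon x hx hxa)
  have h1 : Z.ncard ≤ 2 := (Set.ncard_le_ncard hsub (by simp)).trans 
    ((Set.ncard_insert_le a {b}).trans (by simp))
  have h2 : Z.ncard = n := by
    rw [← Nat.card_coe_set_eq, Nat.card_congr e.toEquiv, Nat.card_fin]
  omega

section Articulation

variable {V : Type u} {G : SimpleGraph V} {S : Set V} {𝒵 : Set (Set V)} {E : Set (Sym2 V)}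
  {Z Z₀ : Set V} {a b : V}

/-- An edge of articulation that is shared with the newly articulated cycle is the new one. -/
theorem pair_mem_of_shared (hS : IsSEACOn G S 𝒵 E) (hab : G.Adj a b)
    (hSZ : S ∩ Z = {a, b}) {Y : Set V} (hY : Y ∈ 𝒵)
    (h : ∃ e ∈ insert s(a, b) E, ∀ x ∈ e, x ∈ Z ∧ x ∈ Y) : a ∈ Y ∧ b ∈ Y := by
  obtain ⟨e, he, hx⟩ := h
  induction e with
  | h x y =>
    have hxy : G.Adj x y := by
      rcases he with he | he
      · exact (he ▸ hab : s(x, y) ∈ G.edgeSet)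
      · exact hS.edges_subset he
    have h1 := hx x (by simp)
    have h2 := hx y (by simp)
    have h3 : x ∈ S ∩ Z := ⟨hS.subset Y hY h1.2, h1.1⟩
    have h4 : y ∈ S ∩ Z := ⟨hS.subset Y hY h2.2, h2.1⟩
    rw [hSZ] at h3 h4
    rcases h3 with rfl | rfl <;> rcases h4 with rfl | rfl
    · exact absurd hxy G.irrefl
    · exact ⟨h1.2, h2.2⟩
    · exact ⟨h2.2, h1.2⟩
    · exact absurd hxy G.irrefl

theorem new_cycle_notMem (hS : IsSEACOn G S 𝒵 E) (hZ : IsInducedCycle G Z)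
    (hSZ : S ∩ Z = {a, b}) : Z ∉ 𝒵 := by
  intro h
  obtain ⟨x, hx, h1, h2⟩ := hZ.exists_third a b
  have : x ∈ S ∩ Z := ⟨hS.subset Z h hx, hx⟩
  rw [hSZ] at this
  rcases this with h | h
  exacts [h1 h, h2 h]

/-- The newly articulated cycle is terminal: its only neighbour is the constituent cycle that
contains the edge of articulation. -/
theorem new_cycle_terminal (hS : IsSEACOn G S 𝒵 E) (hab : G.Adj a b) (hSZ : S ∩ Z = {a, b})
    (hE : s(a, b) ∉ E) (hZ₀ : Z₀ ∈ 𝒵) (ha : a ∈ Z₀) (hb : b ∈ Z₀) :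
    IsTerminalCycle (insert Z 𝒵) (insert s(a, b) E) Z := by
  refine ⟨Or.inl rfl, (Set.encard_le_encard (t := {Z₀}) ?_).trans (by simp)⟩
  rintro Y ⟨hY | hY, hne, he⟩
  · exact absurd hY hne
  have h1 := pair_mem_of_shared hS hab hSZ hY he
  by_contra hY0
  exact hE (hS.mem_of_two_cycles Y hY Z₀ hZ₀ hY0 a b hab.ne h1.1 h1.2 ha hb)

/-- The articulation changes the neighbours of a single one of the earlier cycles. -/
theorem terminal_of_ne (hS : IsSEACOn G S 𝒵 E) (hab : G.Adj a b) (hSZ : S ∩ Z = {a, b})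
    (hE : s(a, b) ∉ E) (hZ₀ : Z₀ ∈ 𝒵) (ha : a ∈ Z₀) (hb : b ∈ Z₀) {Y : Set V}
    (hY : IsTerminalCycle 𝒵 E Y) (hne : Y ≠ Z₀) :
    IsTerminalCycle (insert Z 𝒵) (insert s(a, b) E) Y := by
  have key : ¬ (a ∈ Y ∧ b ∈ Y) := fun h =>
    hE (hS.mem_of_two_cycles Y hY.1 Z₀ hZ₀ hne a b hab.ne h.1 h.2 ha hb)
  refine ⟨Or.inr hY.1, (Set.encard_le_encard ?_).trans hY.2⟩
  rintro X ⟨hX, hXY, e, he, hx⟩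
  rcases hX with rfl | hX
  · exact absurd (pair_mem_of_shared hS hab hSZ hY.1 ⟨e, he, fun x h => (hx x h).symm⟩) key
  · rcases he with rfl | he
    · exact absurd ⟨(hx a (by simp)).1, (hx b (by simp)).1⟩ key
    · exact ⟨hX, hXY, e, he, hx⟩

theorem terminal_of_singleton (Z₀ Z : Set V) (E : Set (Sym2 V)) :
    IsTerminalCycle (insert Z {Z₀}) E Z₀ := by
  refine ⟨Or.inr rfl, (Set.encard_le_encard (t := {Z}) ?_).trans (by simp)⟩
  rintro Y ⟨hY | hY, hne, -⟩
  · exact hY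
  · exact absurd hY hne

end Articulation

/-- The constituent cycles form a tree, so that, apart from any one of them, there is another
terminal cycle. -/
theorem IsSEACOn.exists_terminal_ne {V : Type u} {G : SimpleGraph V} {S : Set V}
    {𝒵 : Set (Set V)} {E : Set (Sym2 V)} (h : IsSEACOn G S 𝒵 E) :
    ∀ Z₀ ∈ 𝒵, 𝒵 = {Z₀} ∨ ∃ Y, IsTerminalCycle 𝒵 E Y ∧ Y ≠ Z₀ := by
  induction h with
  | cycle Z hZ => rintro Y rfl; exact Or.inl rfl
  | articulate S 𝒵 E Z a b hS hZ hab hSZ hE hn ih =>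
    have hmem : a ∈ S ∩ Z ∧ b ∈ S ∩ Z := by rw [hSZ]; simp
    obtain ⟨Z₀, hZ₀, ha, hb⟩ := hS.exists_cycle_of_adj a hmem.1.1 b hmem.2.1 hab
    have hnot := new_cycle_notMem hS hZ hSZ
    rintro Y (rfl | hY)
    · right
      rcases ih Z₀ hZ₀ with rfl | ⟨X, hX, hne⟩
      · exact ⟨Z₀, terminal_of_singleton Z₀ _ _, fun h => hnot (h ▸ rfl)⟩
      · exact ⟨X, terminal_of_ne hS hab hSZ hE hZ₀ ha hb hX hne, fun h => hnot (h ▸ hX.1)⟩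
    · exact Or.inr ⟨Z, new_cycle_terminal hS hab hSZ hE hZ₀ ha hb, fun h => hnot (h ▸ hY)⟩

/-- A vertex common to all terminal cycles lies on every edge of articulation, since these
separate the terminal cycles; so the graph is a fan around it. The inner chords of the fan are
edges of articulation, which is what keeps the next cycle at an end of the path. -/
theorem IsSEACOn.exists_isFan {V : Type u} {G : SimpleGraph V} {S : Set V}
    {𝒵 : Set (Set V)} {E : Set (Sym2 V)} (h : IsSEACOn G S 𝒵 E) (u : V)
    (hu : ∀ Y, IsTerminalCycle 𝒵 E Y → u ∈ Y) :
    ∃ N w, IsFan G u S N w ∧ ∀ k, 0 < k → k < N → G.Adj u (w k) → s(u, w k) ∈ E := by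
  induction h with
  | cycle Z hZ =>
    have : u ∈ Z := hu Z ⟨rfl, (Set.encard_le_encard (t := ∅)
      (fun Y hY => absurd hY.1 hY.2.1)).trans (by simp)⟩
    obtain ⟨N, w, h1, h2⟩ := hZ.exists_isFan this
    exact ⟨N, w, h1, fun k hk hk' h => absurd h (h2 k hk hk')⟩
  | articulate S 𝒵 E Z a b hS hZ hab hSZ hE hn ih =>
    have hmem : a ∈ S ∩ Z ∧ b ∈ S ∩ Z := by rw [hSZ]; simp
    obtain ⟨Z₀, hZ₀, ha, hb⟩ := hS.exists_cycle_of_adj a hmem.1.1 b hmem.2.1 hab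
    have huZ : u ∈ Z := hu Z (new_cycle_terminal hS hab hSZ hE hZ₀ ha hb)
    have huS : u ∈ S := by
      rcases hS.exists_terminal_ne Z₀ hZ₀ with rfl | ⟨Y, hY, hne⟩
      · exact hS.subset Z₀ rfl (hu Z₀ (terminal_of_singleton Z₀ _ _))
      · exact hS.subset Y hY.1 (hu Y (terminal_of_ne hS hab hSZ hE hZ₀ ha hb hY hne))
    have huab : u = a ∨ u = b := by
      have : u ∈ S ∩ Z := ⟨huS, huZ⟩
      rwa [hSZ] at this
    obtain ⟨N, w, hw, hwE⟩ := ih fun Y hY => by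
      by_cases hne : Y = Z₀
      · rcases huab with rfl | rfl
        · exact hne ▸ ha
        · exact hne ▸ hb
      · exact hu Y (terminal_of_ne hS hab hSZ hE hZ₀ ha hb hY hne)
    obtain ⟨M, z, hz, hzE⟩ := hZ.exists_isFan huZ
    -- `c` is the end of the edge of articulation other than `u`
    obtain ⟨c, hc, hSc, hEc, hEc'⟩ : ∃ c, G.Adj u c ∧ S ∩ Z = {u, c} ∧ s(u, c) ∉ E ∧
        s(a, b) = s(u, c) := by
      rcases huab with rfl | rfl
      · exact ⟨b, hab, hSZ, hE, rfl⟩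
      · exact ⟨a, hab.symm, by rw [hSZ, Set.pair_comm], by rwa [Sym2.eq_swap], Sym2.eq_swap⟩
    have hcSZ : c ∈ S ∩ Z := by rw [hSc]; simp
    obtain ⟨N, w, hw, hwE, hwc⟩ : ∃ N w, IsFan G u S N w ∧
        (∀ k, 0 < k → k < N → G.Adj u (w k) → s(u, w k) ∈ E) ∧ w N = c := by
      rcases (hw.mem_iff c).1 hcSZ.1 with h | ⟨i, hi, h⟩
      · exact absurd h.symm hc.ne
      by_cases h0 : i = 0
      · exact ⟨N, _, hw.reverse, fun k h1 h2 => hwE _ (by omega) (by omega), by simp [h, h0]⟩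
      by_cases hN : i = N
      · exact ⟨N, w, hw, hwE, by rw [h, hN]⟩
      · exact absurd (hwE i (by omega) (by omega) (h ▸ hc)) (h ▸ hEc)
    obtain ⟨M, z, hz, hzE, hzc⟩ : ∃ M z, IsFan G u Z M z ∧
        (∀ k, 0 < k → k < M → ¬ G.Adj u (z k)) ∧ z 0 = c := by
      rcases (hz.mem_iff c).1 hcSZ.2 with h | ⟨i, hi, h⟩
      · exact absurd h.symm hc.ne
      by_cases h0 : i = 0
      · exact ⟨M, z, hz, hzE, by rw [h, h0]⟩
      by_cases hN : i = M
      · exact ⟨M, _, hz.reverse, fun k h1 h2 => hzE _ (by omega) (by omega), by simp [h, hN]⟩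
      · exact absurd (h ▸ hc) (hzE i (by omega) (by omega))
    refine ⟨N + M, _, hw.append hz (by rw [hSc, hwc]) (by rw [hzc, hwc]) hn, ?_⟩
    intro k h1 h2
    split_ifs with h3
    · intro hk
      rcases lt_or_eq_of_le h3 with h3 | rfl
      · exact Or.inr (hwE k h1 h3 hk)
      · exact Or.inl (by rw [hwc, hEc'])
    · exact fun hk => absurd hk (hzE _ (by omega) (by omega))

/-! ### Fans with pendant vertices and lower bounds for their multiplicities -/

/-- The vertices whose only neighbour is `z`. -/
noncomputable def pendants {V : Type u} [Fintype V] (G : SimpleGraph V) (z : V) : Finset V := by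
  classical exact Finset.univ.filter fun x => ∀ y, G.Adj x y ↔ y = z

theorem mem_pendants {V : Type u} [Fintype V] {G : SimpleGraph V} {x z : V} :
    x ∈ pendants G z ↔ ∀ y, G.Adj x y ↔ y = z := by
  classical simp [pendants]

/-- `G` consists of a fan with centre `u` and path `w 0, …, w N`, of one pendant vertex `v` at
`u`, and of any number of pendant vertices at the vertices of the path. -/
structure IsPendantFan {V : Type u} [Fintype V] (G : SimpleGraph V) (u v : V) (N : ℕ)
    (w : ℕ → V) : Prop where
  fan : IsFan G u {x | x = u ∨ ∃ i ≤ N, x = w i} N w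
  mem_pendants_center : v ∈ pendants G u
  cover : ∀ x, x = u ∨ x = v ∨ (∃ i ≤ N, x = w i) ∨ ∃ i ≤ N, x ∈ pendants G (w i)

namespace IsPendantFan

variable {V : Type u} [Fintype V] {G : SimpleGraph V} {u v : V} {N : ℕ} {w : ℕ → V}

theorem reverse (h : IsPendantFan G u v N w) : IsPendantFan G u v N (fun i => w (N - i)) where
  fan := by
    have := h.fan.reverse
    rwa [show {x | x = u ∨ ∃ i ≤ N, x = w i} = {x | x = u ∨ ∃ i ≤ N, x = w (N - i)} from
      Set.ext this.mem_iff] at this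
  mem_pendants_center := h.mem_pendants_center
  cover x := by
    have key : ∀ P : V → Prop, (∃ i ≤ N, P (w i)) → ∃ i ≤ N, P (w (N - i)) := by
      rintro P ⟨i, hi, h⟩
      exact ⟨N - i, by omega, by rwa [Nat.sub_sub_self hi]⟩
    rcases h.cover x with h | h | h | h
    · exact Or.inl h
    · exact Or.inr (Or.inl h)
    · exact Or.inr (Or.inr (Or.inl (key _ h)))
    · exact Or.inr (Or.inr (Or.inr (key (fun z => x ∈ pendants G z) h)))

theorem adj_v (h : IsPendantFan G u v N w) (y : V) : G.Adj v y ↔ y = u :=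
  mem_pendants.1 h.mem_pendants_center y

theorem v_ne_u (h : IsPendantFan G u v N w) : v ≠ u :=
  ((h.adj_v u).2 rfl).ne

theorem v_ne (h : IsPendantFan G u v N w) {i : ℕ} (hi : i ≤ N) : v ≠ w i := by
  rintro rfl
  have h1 := h.fan.one_le
  rcases lt_or_eq_of_le hi with h2 | rfl
  · exact h.fan.ne_center (i + 1) h2 ((h.adj_v _).1
      ((h.fan.adj_iff i hi (i + 1) h2).2 (Or.inl rfl)))
  · exact h.fan.ne_center (i - 1) (by omega) ((h.adj_v _).1
      ((h.fan.adj_iff i hi (i - 1) (by omega)).2 (by omega)))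

section Pendant

variable {x : V} {i : ℕ}

theorem pendant_adj (hx : x ∈ pendants G (w i)) (y : V) : G.Adj x y ↔ y = w i :=
  mem_pendants.1 hx y

theorem pendant_ne_center (h : IsPendantFan G u v N w) (hx : x ∈ pendants G (w i)) : x ≠ u := by
  rintro rfl
  have h1 := (pendant_adj hx _).1 h.fan.adj_zero
  have h2 := (pendant_adj hx _).1 h.fan.adj_last
  have := h.fan.inj 0 (by omega) N le_rfl (h1.trans h2.symm)
  have := h.fan.one_le
  omega

theorem pendant_ne_v (h : IsPendantFan G u v N w) (hi : i ≤ N) (hx : x ∈ pendants G (w i)) :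
    x ≠ v := by
  rintro rfl
  exact h.fan.ne_center i hi ((pendant_adj hx _).1 ((h.adj_v u).2 rfl)).symm

theorem pendant_ne (h : IsPendantFan G u v N w) (hi : i ≤ N) (hx : x ∈ pendants G (w i)) {j : ℕ}
    (hj : j ≤ N) : x ≠ w j := by
  rintro rfl
  have h1 := h.fan.one_le
  have key : ∀ k ≤ N, (j + 1 = k ∨ k + 1 = j) → k = i := fun k hk hjk =>
    h.fan.inj k hk i hi ((pendant_adj hx _).1 ((h.fan.adj_iff j hj k hk).2 hjk))
  have hu : ¬ G.Adj (w j) u := fun h' => h.fan.ne_center i hi ((pendant_adj hx _).1 h').symm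
  have h0 : j ≠ 0 := by rintro rfl; exact hu h.fan.adj_zero.symm
  have hN : j ≠ N := by rintro rfl; exact hu h.fan.adj_last.symm
  have := key (j + 1) (by omega) (Or.inl rfl)
  have := key (j - 1) (by omega) (by omega)
  omega

theorem pendant_unique (h : IsPendantFan G u v N w) (hi : i ≤ N) (hx : x ∈ pendants G (w i))
    {j : ℕ} (hj : j ≤ N) (hx' : x ∈ pendants G (w j)) : i = j :=
  h.fan.inj i hi j hj ((pendant_adj hx' _).1 ((pendant_adj hx _).2 rfl))

end Pendant

/-- The tree `G - {u, v}` is directed: along the path and from the pendant vertices to the path; and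
`v` is directed to `u`. The value of `φ` at `w k` is a partial sum of `s`. -/
theorem exists_parent (h : IsPendantFan G u v N w) (s : ℕ → ℝ) :
    ∃ (π : V → V) (φ : V → ℝ), (∀ k < N, π (w k) = w (k + 1) ∧
      φ (w k) = ∑ j ∈ Finset.range (k + 1), s j) ∧
      (∀ k ≤ N, ∀ x ∈ pendants G (w k), π x = w k ∧ φ x = 0) ∧ π v = u ∧ φ v = 0 := by
  have key : ∀ x, ∃ p : V × ℝ, (∀ k < N, x = w k → p.1 = w (k + 1) ∧
      p.2 = ∑ j ∈ Finset.range (k + 1), s j) ∧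
      (∀ k ≤ N, x ∈ pendants G (w k) → p.1 = w k ∧ p.2 = 0) ∧ (x = v → p.1 = u ∧ p.2 = 0) := by
    intro x
    rcases h.cover x with rfl | rfl | ⟨i, hi, rfl⟩ | ⟨i, hi, hx⟩
    · exact ⟨(x, 0), fun k hk hx => absurd hx.symm (h.fan.ne_center k hk.le),
        fun k _ hx => absurd rfl (h.pendant_ne_center hx), fun hx => absurd hx.symm h.v_ne_u⟩
    · exact ⟨(u, 0), fun k hk hx => absurd hx (h.v_ne hk.le),
        fun k hk hx => absurd rfl (h.pendant_ne_v hk hx), fun _ => ⟨rfl, rfl⟩⟩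
    · refine ⟨(w (i + 1), ∑ j ∈ Finset.range (i + 1), s j), fun k hk hx => ?_,
        fun k hk hx => absurd rfl (h.pendant_ne hk hx hi), fun hx => absurd hx.symm (h.v_ne hi)⟩
      rw [h.fan.inj i hi k hk.le hx]
      exact ⟨rfl, rfl⟩
    · refine ⟨(w i, 0), fun k hk hx' => absurd hx' (h.pendant_ne hi hx hk.le), fun k hk hx' => ?_,
        fun hx' => absurd hx' (h.pendant_ne_v hi hx)⟩
      rw [h.pendant_unique hi hx hk hx']
      exact ⟨rfl, rfl⟩
  choose p h1 h2 h3 using key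
  exact ⟨fun x => (p x).1, fun x => (p x).2, fun k hk => h1 _ k hk rfl,
    fun k hk x hx => h2 x k hk hx, h3 v rfl⟩

end IsPendantFan

section Gram

variable {V : Type u} [DecidableEq V] {F : Finset V} {π : V → V} {φ : V → ℝ}
  {u i j : V}

/-- The vectors `e x - e (π x) + φ x • e u`. For `φ = 0`, their Gram matrix is the Laplacian of
the graph with the edges from `x` to `π x`. -/
def edgeVector (π : V → V) (φ : V → ℝ) (u x i : V) : ℝ :=
  (if x = i then 1 else 0) - (if π x = i then 1 else 0) + (if u = i then φ x else 0)

theorem gram_ne_zero_iff (hij : i ≠ j) (hi : i ≠ u) (hj : j ≠ u) :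
    (∑ x ∈ F, edgeVector π φ u x i * edgeVector π φ u x j) ≠ 0 ↔
      (i ∈ F ∧ π i = j) ∨ (j ∈ F ∧ π j = i) := by
  have h1 : ∀ x, edgeVector π φ u x i * edgeVector π φ u x j =
      -(if x = i then (if π i = j then 1 else 0) else 0)
        - (if x = j then (if π j = i then 1 else 0) else 0) := by
    intro x
    unfold edgeVector
    rw [if_neg hi.symm, if_neg hj.symm]
    by_cases hxi : x = i
    · subst hxi
      simp only [hij, if_true, if_false]
      by_cases h : π x = x
      · simp [h, hij]
      · simp [h]
    · by_cases hxj : x = j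
      · subst hxj
        by_cases h : π x = i
        · simp [h, hxi, hij]
        · simp [h, hxi]
      · by_cases h : π x = i
        · simp [h, hxi, hxj, hij]
        · simp [h, hxi, hxj]
  simp only [h1, Finset.sum_sub_distrib, Finset.sum_neg_distrib, Finset.sum_ite_eq']
  by_cases h2 : i ∈ F ∧ π i = j <;> by_cases h3 : j ∈ F ∧ π j = i
  · rw [if_pos h2.1, if_pos h2.2, if_pos h3.1, if_pos h3.2]
    norm_num [h2, h3]
  · rw [if_pos h2.1, if_pos h2.2, ← ite_and, if_neg h3]
    norm_num [h2]
  · rw [← ite_and, if_neg h2, if_pos h3.1, if_pos h3.2]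
    norm_num [h3]
  · rw [← ite_and, ← ite_and, if_neg h2, if_neg h3]
    simp [h2, h3]

theorem gram_center (hu : u ∉ F) (hi : i ≠ u) :
    (∑ x ∈ F, edgeVector π φ u x u * edgeVector π φ u x i) =
      (if i ∈ F then φ i - (if π i = u then 1 else 0) else 0)
        - ∑ x ∈ F with π x = i, φ x := by
  have h1 : ∀ x ∈ F, edgeVector π φ u x u * edgeVector π φ u x i =
      (if x = i then φ i - (if π i = u then 1 else 0) else 0) - (if π x = i then φ x else 0) := by
    intro x hx
    have hxu : x ≠ u := fun h => hu (h ▸ hx)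
    unfold edgeVector
    rw [if_neg hxu, if_pos rfl, if_neg hi.symm]
    by_cases hxi : x = i
    · subst hxi
      by_cases h : π x = x
      · simp [h, hi]
      · simp [h]; ring
    · by_cases h : π x = i
      · simp [h, hxi, hi]
      · simp [h, hxi]
  rw [Finset.sum_congr rfl h1, Finset.sum_sub_distrib, Finset.sum_ite_eq', Finset.sum_filter]

end Gram

namespace IsPendantFan

variable {V : Type u} [Fintype V] [DecidableEq V] {G : SimpleGraph V} {u v : V} {N : ℕ}
  {w : ℕ → V}

/-- The vertices whose edge to their parent is not incident with one of the vertices `w d`,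
`d ∈ D`; the vertex `v` is included if `b` holds. -/
noncomputable def freeEdges (_ : IsPendantFan G u v N w) (D : Finset ℕ) (b : Prop) :
    Finset V := by
  classical exact Finset.univ.filter fun x => (∃ k < N, x = w k ∧ k ∉ D ∧ k + 1 ∉ D) ∨
    (∃ k ≤ N, k ∉ D ∧ x ∈ pendants G (w k)) ∨ (x = v ∧ b)

variable {D J : Finset ℕ} {b : Prop}

theorem mem_freeEdges (h : IsPendantFan G u v N w) {x : V} :
    x ∈ h.freeEdges D b ↔ (∃ k < N, x = w k ∧ k ∉ D ∧ k + 1 ∉ D) ∨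
    (∃ k ≤ N, k ∉ D ∧ x ∈ pendants G (w k)) ∨ (x = v ∧ b) := by
  classical simp [freeEdges]

theorem center_notMem_freeEdges (h : IsPendantFan G u v N w) : u ∉ h.freeEdges D b := by
  rw [mem_freeEdges]
  rintro (⟨k, hk, hx, -⟩ | ⟨k, hk, -, hx⟩ | ⟨hx, -⟩)
  · exact h.fan.ne_center k hk.le hx.symm
  · exact h.pendant_ne_center hx rfl
  · exact h.v_ne_u hx.symm

theorem path_mem_freeEdges (h : IsPendantFan G u v N w) {k : ℕ} (hk : k ≤ N) :
    w k ∈ h.freeEdges D b ↔ k < N ∧ k ∉ D ∧ k + 1 ∉ D := by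
  rw [mem_freeEdges]
  constructor
  · rintro (⟨l, hl, hx, h1⟩ | ⟨l, hl, -, hx⟩ | ⟨hx, -⟩)
    · rw [h.fan.inj k hk l hl.le hx]
      exact ⟨hl, h1⟩
    · exact absurd rfl (h.pendant_ne hl hx hk)
    · exact absurd hx.symm (h.v_ne hk)
  · exact fun h1 => Or.inl ⟨k, h1.1, rfl, h1.2⟩

theorem pendant_mem_freeEdges (h : IsPendantFan G u v N w) {k : ℕ} (hk : k ≤ N) {x : V}
    (hx : x ∈ pendants G (w k)) : x ∈ h.freeEdges D b ↔ k ∉ D := by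
  rw [mem_freeEdges]
  constructor
  · rintro (⟨l, hl, hx', -⟩ | ⟨l, hl, h1, hx'⟩ | ⟨hx', -⟩)
    · exact absurd hx' (h.pendant_ne hk hx hl.le)
    · rwa [h.pendant_unique hk hx hl hx']
    · exact absurd hx' (h.pendant_ne_v hk hx)
  · exact fun h1 => Or.inr (Or.inl ⟨k, hk, h1, hx⟩)

theorem v_mem_freeEdges (h : IsPendantFan G u v N w) : v ∈ h.freeEdges D b ↔ b := by
  rw [mem_freeEdges]
  constructor
  · rintro (⟨l, hl, hx', -⟩ | ⟨l, hl, h1, hx'⟩ | ⟨-, hb⟩)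
    · exact absurd hx' (h.v_ne hl.le)
    · exact absurd rfl (h.pendant_ne_v hl hx')
    · exact hb
  · exact fun hb => Or.inr (Or.inr ⟨rfl, hb⟩)

theorem le_card_compl_freeEdges (h : IsPendantFan G u v N w) (hD : ∀ d ∈ D, d ≤ N)
    (hJ : ∀ j ∈ J, j ≤ N ∧ (j = N ∨ j ∈ D ∨ j + 1 ∈ D)) :
    1 + J.card + ∑ d ∈ D, (pendants G (w d)).card ≤
      ((h.freeEdges D True)ᶜ).card := by
  have hJc : (J.image w).card = J.card := Finset.card_image_of_injOn fun i hi j hj hij =>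
    h.fan.inj i (hJ i hi).1 j (hJ j hj).1 hij
  have hPc : (D.biUnion fun d => pendants G (w d)).card = ∑ d ∈ D, (pendants G (w d)).card := by
    refine Finset.card_biUnion fun d hd e he hde => ?_
    rw [Function.onFun, Finset.disjoint_left]
    exact fun x hx hx' => hde (h.pendant_unique (hD d hd) hx (hD e he) hx')
  have h1 : Disjoint (J.image w) (D.biUnion fun d => pendants G (w d)) := by
    rw [Finset.disjoint_left]
    intro x hx hx'
    obtain ⟨j, hj, rfl⟩ := Finset.mem_image.1 hx
    obtain ⟨d, hd, hx'⟩ := Finset.mem_biUnion.1 hx'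
    exact h.pendant_ne (hD d hd) hx' (hJ j hj).1 rfl
  have h2 : u ∉ J.image w ∪ D.biUnion fun d => pendants G (w d) := by
    rw [Finset.mem_union, Finset.mem_image, Finset.mem_biUnion]
    rintro (⟨j, hj, hx⟩ | ⟨d, hd, hx⟩)
    · exact h.fan.ne_center j (hJ j hj).1 hx
    · exact h.pendant_ne_center hx rfl
  rw [add_assoc, add_comm, ← hJc, ← hPc, ← Finset.card_union_of_disjoint h1,
    ← Finset.card_insert_of_notMem h2]
  refine Finset.card_le_card fun x hx => ?_
  rw [Finset.mem_compl]
  rcases Finset.mem_insert.1 hx with rfl | hx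
  · exact h.center_notMem_freeEdges
  rcases Finset.mem_union.1 hx with hx | hx
  · obtain ⟨j, hj, rfl⟩ := Finset.mem_image.1 hx
    rw [h.path_mem_freeEdges (hJ j hj).1]
    rcases (hJ j hj).2 with h3 | h3 | h3
    · exact fun h4 => absurd h3 h4.1.ne
    · exact fun h4 => h4.2.1 h3
    · exact fun h4 => h4.2.2 h3
  · obtain ⟨d, hd, hx⟩ := Finset.mem_biUnion.1 hx
    rw [h.pendant_mem_freeEdges (hD d hd) hx]
    exact fun h3 => h3 hd

/-- Away from `u`, the Gram matrix of the free edges has the pattern of `G - D`. -/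
theorem gram_path (h : IsPendantFan G u v N w) {π : V → V} {φ : V → ℝ}
    (hw : ∀ k < N, π (w k) = w (k + 1)) (hp : ∀ k ≤ N, ∀ x ∈ pendants G (w k), π x = w k)
    (hv : π v = u) {i j : V} (hij : i ≠ j) (hi : i ≠ u) (hj : j ≠ u) (hiD : i ∉ D.image w)
    (hjD : j ∉ D.image w) :
    (∑ x ∈ h.freeEdges D b, edgeVector π φ u x i * edgeVector π φ u x j) ≠ 0 ↔ G.Adj i j := by
  rw [gram_ne_zero_iff hij hi hj]
  have h1 : ∀ i j, j ≠ u → i ∈ h.freeEdges D b → π i = j → G.Adj i j := by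
    rintro i j hj hi rfl
    rcases h.mem_freeEdges.1 hi with ⟨k, hk, rfl, -⟩ | ⟨k, hk, -, hx⟩ | ⟨rfl, -⟩
    · rw [hw k hk, h.fan.adj_iff k hk.le (k + 1) hk]
      exact Or.inl rfl
    · rw [hp k hk i hx]
      exact (pendant_adj hx _).2 rfl
    · exact absurd hv hj
  have hD : ∀ k, w k ∉ D.image w → k ∉ D := fun k hk hkD => hk (Finset.mem_image_of_mem w hkD)
  constructor
  · rintro (⟨h2, h3⟩ | ⟨h2, h3⟩)
    · exact h1 i j hj h2 h3
    · exact (h1 j i hi h2 h3).symm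
  · intro hadj
    rcases h.cover i with rfl | rfl | ⟨k, hk, rfl⟩ | ⟨k, hk, hx⟩
    · exact absurd rfl hi
    · exact absurd ((h.adj_v _).1 hadj) hj
    · rcases h.cover j with rfl | rfl | ⟨l, hl, rfl⟩ | ⟨l, hl, hy⟩
      · exact absurd rfl hj
      · exact absurd ((h.adj_v _).1 hadj.symm) hi
      · rw [h.path_mem_freeEdges hk, h.path_mem_freeEdges hl]
        rcases (h.fan.adj_iff k hk l hl).1 hadj with rfl | rfl
        · exact Or.inl ⟨⟨hl, hD _ hiD, hD _ hjD⟩, hw k hl⟩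
        · exact Or.inr ⟨⟨hk, hD _ hjD, hD _ hiD⟩, hw l hk⟩
      · have := (pendant_adj hy _).1 hadj.symm
        rw [h.pendant_mem_freeEdges hl hy, hp l hl j hy]
        exact Or.inr ⟨hD l (this ▸ hiD), this.symm⟩
    · have := (pendant_adj hx _).1 hadj
      rw [h.pendant_mem_freeEdges hk hx, hp k hk i hx]
      exact Or.inl ⟨hD k (this ▸ hjD), this.symm⟩

/-- The bound obtained by deleting `u` and the vertices `w d`, `d ∈ D`, from `G`: each
component that is left contributes a null vector. -/
theorem le_maxMult_of_center_deleted (h : IsPendantFan G u v N w) (hD : ∀ d ∈ D, d ≤ N)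
    (hJ : ∀ j ∈ J, j ≤ N ∧ (j = N ∨ j ∈ D ∨ j + 1 ∈ D)) :
    J.card + ∑ d ∈ D, (pendants G (w d)).card ≤ maxMult G + 2 * D.card := by
  obtain ⟨π, φ, hw, hp, hv, -⟩ := h.exists_parent 0
  have hF : h.freeEdges D True = insert v (h.freeEdges D False) := by
    ext x
    simp only [Finset.mem_insert, mem_freeEdges, and_true, and_false, or_false]
    generalize (∃ k < N, x = w k ∧ k ∉ D ∧ k + 1 ∉ D) = p
    generalize (∃ k ≤ N, k ∉ D ∧ x ∈ pendants G (w k)) = q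
    tauto
  have hvF : v ∉ h.freeEdges D False := fun hx => h.v_mem_freeEdges.1 hx
  have h1 := h.le_card_compl_freeEdges hD hJ
  have h2 := card_le_maxMult_add G (h.freeEdges D False)ᶜ (insert u (D.image w))
    (edgeVector π φ u) (fun i j hij hi hj => by
      rw [compl_compl]
      simp only [Finset.mem_insert, not_or] at hi hj
      exact h.gram_path (fun k hk => (hw k hk).1) (fun k hk x hx => (hp k hk x hx).1) hv hij
        hi.1 hj.1 hi.2 hj.2)
  have h3 : (insert u (D.image w)).card ≤ D.card + 1 :=
    (Finset.card_insert_le _ _).trans (Nat.add_le_add_right Finset.card_image_le _)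
  have h4 := Finset.card_compl_add_card (h.freeEdges D True)
  have h5 := Finset.card_compl_add_card (h.freeEdges D False)
  rw [hF, Finset.card_insert_of_notMem hvF] at h4
  rw [hF] at h1
  omega

/-- The bound obtained by deleting the vertices `w d`, `d ∈ D`, from `G`. The numbers `s k`
become the entries between `u` and `w k`. That `s` has sum zero on each of the intervals into which
`D` divides the path makes it a combination of the rows of the Laplacian of the path; so
joining `u` to the path does not raise the rank. -/
theorem le_maxMult_of_balanced (h : IsPendantFan G u v N w) (hD : ∀ d ∈ D, d ≤ N)
    (hJ : ∀ j ∈ J, j ≤ N ∧ (j = N ∨ j ∈ D ∨ j + 1 ∈ D)) (s : ℕ → ℝ)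
    (hs : ∀ k ≤ N, k ∉ D → (s k ≠ 0 ↔ G.Adj u (w k)))
    (hsum : ∑ j ∈ Finset.range (N + 1), s j = 0)
    (hsD : ∀ d ∈ D, ∑ j ∈ Finset.range d, s j = 0 ∧ s d = 0) :
    1 + J.card + ∑ d ∈ D, (pendants G (w d)).card ≤ maxMult G + 2 * D.card := by
  obtain ⟨π, φ, hw, hp, hv, hφv⟩ := h.exists_parent s
  have hcenter : ∀ i, i ≠ u → i ∉ D.image w →
      ((∑ x ∈ h.freeEdges D True, edgeVector π φ u x u * edgeVector π φ u x i) ≠ 0 ↔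
        G.Adj u i) := by
    intro i hi hiD
    rw [gram_center h.center_notMem_freeEdges hi]
    -- the vertices with parent `i`
    have hpar : ∀ x ∈ h.freeEdges D True, π x = i → (∃ k < N, x = w k ∧ w (k + 1) = i) ∨
        (φ x = 0 ∧ ∃ k ≤ N, w k = i) := by
      intro x hx hxi
      rcases h.mem_freeEdges.1 hx with ⟨k, hk, rfl, -⟩ | ⟨k, hk, -, hx⟩ | ⟨rfl, -⟩
      · exact Or.inl ⟨k, hk, rfl, by rw [← hxi, (hw k hk).1]⟩
      · exact Or.inr ⟨(hp k hk x hx).2, k, hk, by rw [← hxi, (hp k hk x hx).1]⟩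
      · exact absurd (hxi.symm.trans hv) hi
    have hnopar : (∀ k ≤ N, w k ≠ i) →
        ∑ x ∈ h.freeEdges D True with π x = i, φ x = 0 := by
      refine fun hne => Finset.sum_eq_zero fun x hx => ?_
      rw [Finset.mem_filter] at hx
      rcases hpar x hx.1 hx.2 with ⟨k, hk, -, hk'⟩ | ⟨h0, -⟩
      · exact absurd hk' (hne (k + 1) hk)
      · exact h0
    rcases h.cover i with rfl | rfl | ⟨k, hk, rfl⟩ | ⟨k, hk, hx⟩
    · exact absurd rfl hi
    · rw [hnopar (fun k hk => (h.v_ne hk).symm), if_pos (h.v_mem_freeEdges.2 trivial), hv,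
        if_pos rfl, hφv, G.adj_comm, h.adj_v]
      simp
    · have hkD : k ∉ D := fun hkD => hiD (Finset.mem_image_of_mem w hkD)
      have h1 : (if w k ∈ h.freeEdges D True then φ (w k) - (if π (w k) = u then 1 else 0)
          else 0) = ∑ j ∈ Finset.range (k + 1), s j := by
        split_ifs with h2 h3
        · rw [h.path_mem_freeEdges hk] at h2
          rw [(hw k h2.1).1] at h3
          exact absurd h3 (h.fan.ne_center _ h2.1)
        · rw [h.path_mem_freeEdges hk] at h2
          rw [(hw k h2.1).2, sub_zero]
        · rw [h.path_mem_freeEdges hk] at h2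
          rcases lt_or_eq_of_le hk with hk' | rfl
          · have : k + 1 ∈ D := by tauto
            rw [(hsD _ this).1]
          · exact hsum.symm
      have h2 : ∑ x ∈ h.freeEdges D True with π x = w k, φ x = ∑ j ∈ Finset.range k, s j := by
        rcases k with - | k
        · rw [Finset.range_zero, Finset.sum_empty]
          refine Finset.sum_eq_zero fun x hx => ?_
          rw [Finset.mem_filter] at hx
          rcases hpar x hx.1 hx.2 with ⟨l, hl, -, hl'⟩ | ⟨h0, -⟩
          · have := h.fan.inj (l + 1) hl 0 hk hl'
            omega
          · exact h0
        · by_cases hkD' : k ∈ D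
          · rw [Finset.sum_range_succ, (hsD k hkD').1, (hsD k hkD').2, add_zero]
            refine Finset.sum_eq_zero fun x hx => ?_
            rw [Finset.mem_filter] at hx
            rcases hpar x hx.1 hx.2 with ⟨l, hl, rfl, hl'⟩ | ⟨h0, -⟩
            · have := h.fan.inj (l + 1) hl (k + 1) hk hl'
              have hlF := (h.path_mem_freeEdges hl.le).1 hx.1
              obtain rfl : l = k := by omega
              exact absurd hkD' hlF.2.1
            · exact h0
          · rw [← (hw k hk).2]
            refine Finset.sum_eq_single_of_mem (w k) ?_ fun x hx hxk => ?_
            · rw [Finset.mem_filter, h.path_mem_freeEdges (by omega)]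
              exact ⟨⟨hk, hkD', hkD⟩, (hw k hk).1⟩
            · rw [Finset.mem_filter] at hx
              rcases hpar x hx.1 hx.2 with ⟨l, hl, rfl, hl'⟩ | ⟨h0, -⟩
              · have := h.fan.inj (l + 1) hl (k + 1) hk hl'
                obtain rfl : l = k := by omega
                exact absurd rfl hxk
              · exact h0
      rw [h1, h2, Finset.sum_range_succ, add_sub_cancel_left]
      exact hs k hk hkD
    · rw [hnopar (fun l hl => (h.pendant_ne hk hx hl).symm), (hp k hk i hx).1, (hp k hk i hx).2,
        if_neg (h.fan.ne_center k hk), G.adj_comm, pendant_adj hx]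
      simpa using (h.fan.ne_center k hk).symm
  have h1 := h.le_card_compl_freeEdges hD hJ
  have h2 := card_le_maxMult_add G (h.freeEdges D True)ᶜ (D.image w)
    (edgeVector π φ u) (fun i j hij hi hj => by
      rw [compl_compl]
      by_cases hiu : i = u
      · subst hiu
        exact hcenter j hij.symm hj
      by_cases hju : j = u
      · subst hju
        rw [G.adj_comm, ← hcenter i hij hi]
        simp only [mul_comm]
      exact h.gram_path (fun k hk => (hw k hk).1) (fun k hk x hx => (hp k hk x hx).1) hv hij
        hiu hju hi hj)
  have h3 : (D.image w).card ≤ D.card := Finset.card_image_le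
  omega

end IsPendantFan

/-! ### Where the pendant vertices are if the multiplicity is at most two -/

/-- If the interval from `a` to `b - 1` holds no single element of `K`, there is a sequence with
support `K` in the interval that sums to zero. -/
theorem exists_balanced (K : ℕ → Prop) {a b k₁ k₂ : ℕ} (h₁ : a ≤ k₁) (h₁' : k₁ < b)
    (hK₁ : K k₁) (h₂ : a ≤ k₂) (h₂' : k₂ < b) (hK₂ : K k₂) (hne : k₁ ≠ k₂) :
    ∃ s : ℕ → ℝ, (∀ k, s k ≠ 0 ↔ a ≤ k ∧ k < b ∧ K k) ∧
      (∀ m ≤ a, ∑ j ∈ Finset.range m, s j = 0) ∧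
      (∀ m, b ≤ m → ∑ j ∈ Finset.range m, s j = 0) := by
  classical
  let I : Finset ℕ := (Finset.Ico a b).filter K
  have hI : ∀ k, k ∈ I ↔ a ≤ k ∧ k < b ∧ K k := fun k => by simp [I, and_assoc]
  have hk₁ : k₁ ∈ I := (hI _).2 ⟨h₁, h₁', hK₁⟩
  have hcard : 1 < I.card := Finset.one_lt_card.2 ⟨k₁, hk₁, k₂, (hI _).2 ⟨h₂, h₂', hK₂⟩, hne⟩
  have hcard' : (1 : ℝ) < I.card := by exact_mod_cast hcard
  have hout : ∀ k, k ∉ I → (if k ∈ I then (if k = k₁ then 1 - (I.card : ℝ) else 1) else 0) = 0 :=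
    fun k hk => if_neg hk
  refine ⟨fun k => if k ∈ I then (if k = k₁ then 1 - (I.card : ℝ) else 1) else 0,
    fun k => ?_, fun m hm => Finset.sum_eq_zero fun k hk => ?_, fun m hm => ?_⟩
  · rw [← hI]
    by_cases h1 : k ∈ I
    · by_cases h2 : k = k₁
      · simp only [h2, hk₁, if_true, ne_eq, iff_true]
        linarith
      · simp [h1, h2]
    · simp [h1]
  · refine hout k fun h => ?_
    rw [Finset.mem_range] at hk
    have := (hI k).1 h
    omega
  · rw [← Finset.sum_subset (s₁ := I) (fun k hk => by
      rw [Finset.mem_range]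
      have := (hI k).1 hk
      omega) (fun k _ hk => hout k hk), ← Finset.add_sum_erase I _ hk₁,
      Finset.sum_congr (s₂ := I.erase k₁) (g := fun _ => 1) rfl (fun k hk => by
        rw [Finset.mem_erase] at hk
        rw [if_pos hk.2, if_neg hk.1])]
    rw [if_pos hk₁, if_pos rfl, Finset.sum_const, Finset.card_erase_of_mem hk₁, nsmul_eq_mul,
      Nat.cast_sub hcard.le]
    push_cast
    ring

namespace IsPendantFan

variable {V : Type u} [Fintype V] [DecidableEq V] {G : SimpleGraph V} {u v : V} {N : ℕ}
  {w : ℕ → V}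

theorem two_le_maxMult (h : IsPendantFan G u v N w) : 2 ≤ maxMult G := by
  have hN := h.fan.one_le
  obtain ⟨s, h1, -, h3⟩ := exists_balanced (fun k => G.Adj u (w k)) (a := 0) (b := N + 1)
    (k₁ := 0) (k₂ := N) (by omega) (by omega) h.fan.adj_zero (by omega) (by omega) h.fan.adj_last
    (by omega)
  have := h.le_maxMult_of_balanced (D := ∅) (J := {N}) (by simp) (by simp) s
    (fun k hk _ => by rw [h1]; simp; omega) (h3 _ le_rfl) (by simp)
  simpa using this

section

variable (h : IsPendantFan G u v N w) (hM : maxMult G ≤ 2)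
include h hM

theorem card_pendants_zero_le : (pendants G (w 0)).card ≤ 2 := by
  have hN := h.fan.one_le
  have := h.le_maxMult_of_center_deleted (D := {0}) (J := {N, 0}) (by simp) (by simp)
  rw [Finset.card_pair (by omega), Finset.sum_singleton, Finset.card_singleton] at this
  omega

theorem card_pendants_le_one {i : ℕ} (h0 : 0 < i) (hi : i < N) :
    (pendants G (w i)).card ≤ 1 := by
  have := h.le_maxMult_of_center_deleted (D := {i}) (J := {N, i, i - 1})
    (by simp; omega) (by simp; omega)
  rw [Finset.card_insert_of_notMem (by simp; omega), Finset.card_pair (by omega),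
    Finset.sum_singleton, Finset.card_singleton] at this
  omega

theorem consecutive_of_pendants {i j : ℕ} (h0 : 0 < i) (hij : i < j) (hj : j < N)
    (hi' : 0 < (pendants G (w i)).card) (hj' : 0 < (pendants G (w j)).card) : j = i + 1 := by
  by_contra hne
  have := h.le_maxMult_of_center_deleted (D := {i, j}) (J := {N, i, i - 1, j, j - 1})
    (by simp; omega) (by simp; omega)
  rw [Finset.card_insert_of_notMem (by simp; omega), Finset.card_insert_of_notMem (by simp; omega),
    Finset.card_insert_of_notMem (by simp; omega), Finset.card_pair (by omega),
    Finset.sum_pair (by omega), Finset.card_pair (by omega)] at this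
  omega

theorem eq_one_of_two_pendants {i : ℕ} (h0 : 2 ≤ (pendants G (w 0)).card) (hi0 : 0 < i)
    (hi : i < N) (hi' : 0 < (pendants G (w i)).card) : i = 1 := by
  by_contra hne
  have := h.le_maxMult_of_center_deleted (D := {0, i}) (J := {N, 0, i, i - 1})
    (by simp; omega) (by simp; omega)
  rw [Finset.card_insert_of_notMem (by simp; omega), Finset.card_insert_of_notMem (by simp; omega),
    Finset.card_pair (by omega), Finset.sum_pair (by omega), Finset.card_pair (by omega)] at this
  omega

theorem not_chords_both_sides {i k l : ℕ} (hi' : 0 < (pendants G (w i)).card)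
    (hk0 : 0 < k) (hk : k < i) (hku : G.Adj u (w k)) (hl : i < l) (hlN : l < N)
    (hlu : G.Adj u (w l)) : False := by
  obtain ⟨s, h1, h2, h3⟩ := exists_balanced (fun k => G.Adj u (w k)) (a := 0) (b := i)
    (k₁ := 0) (k₂ := k) (by omega) (by omega) h.fan.adj_zero (by omega) (by omega) hku (by omega)
  obtain ⟨s', h1', h2', h3'⟩ := exists_balanced (fun k => G.Adj u (w k)) (a := i + 1) (b := N + 1)
    (k₁ := N) (k₂ := l) (by omega) (by omega) h.fan.adj_last (by omega) (by omega) hlu (by omega)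
  have hz : ∀ j, i ≤ j → s j = 0 := fun j hj => by
    by_contra hne
    have := (h1 j).1 hne
    omega
  have hz' : ∀ j, j ≤ i → s' j = 0 := fun j hj => by
    by_contra hne
    have := (h1' j).1 hne
    omega
  have := h.le_maxMult_of_balanced (D := {i}) (J := {N, i, i - 1})
    (by simp; omega) (by simp; omega) (fun j => s j + s' j) (fun j hj hjD => by
      rcases lt_or_ge j i with h4 | h4
      · rw [hz' j h4.le, add_zero, h1]
        simp [h4]
      · have : j ≠ i := by simpa using hjD
        rw [hz j h4, zero_add, h1']
        constructor
        · exact fun h5 => h5.2.2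
        · exact fun h5 => ⟨by omega, by omega, h5⟩) (by
      rw [Finset.sum_add_distrib, h3 _ (by omega), h3' _ le_rfl, add_zero]) (by
      intro d hd
      rw [Finset.mem_singleton] at hd
      subst hd
      rw [Finset.sum_add_distrib, h3 _ le_rfl, h2' _ (by omega), hz _ le_rfl, hz' _ le_rfl]
      simp)
  rw [Finset.card_insert_of_notMem (by simp; omega), Finset.card_pair (by omega),
    Finset.sum_singleton, Finset.card_singleton] at this
  omega

theorem not_chord_of_pendants {i k : ℕ} (h0 : 0 < (pendants G (w 0)).card) (hi1 : 1 < i)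
    (hi' : 0 < (pendants G (w i)).card) (hk : i < k) (hkN : k < N) (hku : G.Adj u (w k)) :
    False := by
  by_cases hl : ∃ l, 0 < l ∧ l < i ∧ G.Adj u (w l)
  · obtain ⟨l, hl0, hli, hlu⟩ := hl
    exact h.not_chords_both_sides hM hi' hl0 hli hlu hk hkN hku
  push Not at hl
  obtain ⟨s, h1, h2, h3⟩ := exists_balanced (fun k => G.Adj u (w k)) (a := i + 1) (b := N + 1)
    (k₁ := N) (k₂ := k) (by omega) (by omega) h.fan.adj_last (by omega) (by omega) hku (by omega)
  have hz : ∀ j, j ≤ i → s j = 0 := fun j hj => by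
    by_contra hne
    have := (h1 j).1 hne
    omega
  have := h.le_maxMult_of_balanced (D := {0, i}) (J := {N, 0, i, i - 1})
    (by simp; omega) (by simp; omega) s (fun j hj hjD => by
      simp only [Finset.mem_insert, Finset.mem_singleton, not_or] at hjD
      rcases lt_or_ge j i with h4 | h4
      · rw [hz j h4.le]
        simpa using hl j (by omega) h4
      · rw [h1]
        constructor
        · exact fun h5 => h5.2.2
        · exact fun h5 => ⟨by omega, by omega, h5⟩) (h3 _ le_rfl) (by
      intro d hd
      rw [Finset.mem_insert, Finset.mem_singleton] at hd
      rcases hd with rfl | rfl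
      · exact ⟨h2 _ (by omega), hz _ (by omega)⟩
      · exact ⟨h2 _ (by omega), hz _ (by omega)⟩)
  rw [Finset.card_insert_of_notMem (by simp; omega), Finset.card_insert_of_notMem (by simp; omega),
    Finset.card_pair (by omega), Finset.sum_pair (by omega), Finset.card_pair (by omega)] at this
  omega

theorem not_chord_of_two_pendants {k : ℕ} (h0 : 2 ≤ (pendants G (w 0)).card) (hk0 : 0 < k)
    (hkN : k < N) (hku : G.Adj u (w k)) : False := by
  obtain ⟨s, h1, h2, h3⟩ := exists_balanced (fun k => G.Adj u (w k)) (a := 1) (b := N + 1)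
    (k₁ := N) (k₂ := k) (by omega) (by omega) h.fan.adj_last (by omega) (by omega) hku (by omega)
  have := h.le_maxMult_of_balanced (D := {0}) (J := {N, 0})
    (by simp) (by simp) s (fun j hj hjD => by
      have : j ≠ 0 := by simpa using hjD
      rw [h1]
      constructor
      · exact fun h5 => h5.2.2
      · exact fun h5 => ⟨by omega, by omega, h5⟩) (h3 _ le_rfl) (by
      intro d hd
      rw [Finset.mem_singleton] at hd
      subst hd
      refine ⟨h2 _ (by omega), ?_⟩
      by_contra hne
      have := (h1 0).1 hne
      omega)
  rw [Finset.card_pair (by omega), Finset.sum_singleton, Finset.card_singleton] at this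
  omega

theorem not_three_end_pendants (hN : 2 ≤ N) (h0 : 2 ≤ (pendants G (w 0)).card)
    (h0N : 0 < (pendants G (w N)).card) : False := by
  have := h.le_maxMult_of_balanced (D := {0, N}) (J := {N, N - 1, 0})
    (by simp) (by simp; omega) (fun _ => 0) (fun j hj hjD => by
      simp only [Finset.mem_insert, Finset.mem_singleton, not_or] at hjD
      simpa using fun h5 => h.not_chord_of_two_pendants hM h0 (by omega) (by omega) h5)
    (by simp) (by simp)
  rw [Finset.card_insert_of_notMem (by simp; omega), Finset.card_pair (by omega),
    Finset.sum_pair (by omega), Finset.card_pair (by omega)] at this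
  omega

theorem not_four_end_pendants (hN : N = 1) (h0 : 2 ≤ (pendants G (w 0)).card)
    (h0N : 2 ≤ (pendants G (w N)).card) : False := by
  subst hN
  have := h.le_maxMult_of_balanced (D := {0, 1}) (J := {0, 1})
    (by simp) (by simp) (fun _ => 0) (fun j hj hjD => by
      simp only [Finset.mem_insert, Finset.mem_singleton, not_or] at hjD
      omega)
    (by simp) (by simp)
  rw [Finset.sum_pair (by omega), Finset.card_pair (by omega)] at this
  omega

end

theorem not_pendants_ends_and_inner (h : IsPendantFan G u v N w) (hM : maxMult G ≤ 2) {i : ℕ}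
    (hi1 : 1 < i) (hiN : i + 1 < N) (h0 : 0 < (pendants G (w 0)).card)
    (h0N : 0 < (pendants G (w N)).card) (hi' : 0 < (pendants G (w i)).card) : False := by
  have hR : ∀ k, i < k → k < N → ¬ G.Adj u (w k) := fun k h1 h2 h3 =>
    h.not_chord_of_pendants hM h0 hi1 hi' h1 h2 h3
  have hL : ∀ k, 0 < k → k < i → ¬ G.Adj u (w k) := fun k h1 h2 h3 =>
    h.reverse.not_chord_of_pendants hM (i := N - i) (k := N - k) (by simpa using h0N) (by omega)
      (by simpa [Nat.sub_sub_self (show i ≤ N by omega)] using hi') (by omega) (by omega)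
      (by simpa [Nat.sub_sub_self (show k ≤ N by omega)] using h3)
  have := h.le_maxMult_of_balanced (D := {0, i, N}) (J := {N, N - 1, 0, i, i - 1})
    (by simp; omega) (by simp; omega) (fun _ => 0) (fun j hj hjD => by
      simp only [Finset.mem_insert, Finset.mem_singleton, not_or] at hjD
      rcases lt_or_ge j i with h4 | h4
      · simpa using hL j (by omega) h4
      · simpa using hR j (by omega) (by omega))
    (by simp) (by simp)
  rw [Finset.card_insert_of_notMem (by simp; omega), Finset.card_insert_of_notMem (by simp; omega),
    Finset.card_insert_of_notMem (by simp; omega), Finset.card_pair (by omega),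
    Finset.sum_insert (by simp; omega), Finset.sum_pair (by omega),
    Finset.card_insert_of_notMem (by simp; omega), Finset.card_pair (by omega)] at this
  omega

end IsPendantFan

/-- The positions on the path of a fan at which two induced paths may be separated: `c i` is the
number of pendant vertices at `w i`, and `K i` says that `w i` is adjacent to the centre. The
first alternative separates `G - {u, v}`, into the parts below `r` and from `r` on; the second
separates `G - v`, into the part from `s` to `t` and the rest, which is joined through `u`. -/
theorem exists_separation {N : ℕ} (hN : 1 ≤ N) {c : ℕ → ℕ} {K : ℕ → Prop}
    (f0 : c 0 ≤ 2) (f0' : c N ≤ 2) (f1 : ∀ i, 0 < i → i < N → c i ≤ 1)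
    (f2 : ∀ i j, 0 < i → i < j → j < N → 0 < c i → 0 < c j → j = i + 1)
    (f3 : ∀ i, 2 ≤ c 0 → 0 < i → i < N → 0 < c i → i = 1)
    (f3' : ∀ i, 2 ≤ c N → 0 < i → i < N → 0 < c i → i + 1 = N)
    (h1 : ∀ i k l, 0 < c i → 0 < k → k < i → K k → i < l → l < N → K l → False)
    (h2 : ∀ i k, 0 < c 0 → 1 < i → 0 < c i → i < k → k < N → K k → False)
    (h2' : ∀ i k, 0 < c N → i + 1 < N → 0 < c i → 0 < k → k < i → K k → False)
    (h3 : ∀ i, 1 < i → i + 1 < N → 0 < c 0 → 0 < c N → 0 < c i → False)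
    (h4 : ∀ k, 2 ≤ c 0 → 0 < k → k < N → K k → False)
    (h4' : ∀ k, 2 ≤ c N → 0 < k → k < N → K k → False)
    (h5 : 2 ≤ N → 2 ≤ c 0 → 0 < c N → False) (h5' : 2 ≤ N → 2 ≤ c N → 0 < c 0 → False)
    (h6 : N = 1 → 2 ≤ c 0 → 2 ≤ c N → False) :
    (∃ r, 1 ≤ r ∧ r ≤ N ∧ (∀ i ≤ N, 0 < c i → i = 0 ∨ i + 1 = r ∨ i = r ∨ i = N) ∧
      ∀ i ≤ N, c i ≤ 1 ∨ (c i ≤ 2 ∧ ((i = 0 ∧ r = 1) ∨ (i = N ∧ r = N)))) ∧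
    (∃ s t, s ≤ t ∧ t ≤ N ∧ (∀ k, 0 < k → k < s → ¬ K k) ∧ (∀ k, t < k → k < N → ¬ K k) ∧
      (∀ i ≤ N, 0 < c i → i + 1 = s ∨ i = s ∨ i = t ∨ i = t + 1) ∧
      ∀ i ≤ N, c i ≤ 1 ∨ (c i ≤ 2 ∧ i = s ∧ s = t)) := by
  have hc : ∀ i ≤ N, i ≠ 0 → i ≠ N → c i ≤ 1 := fun i hi hi0 hiN => f1 i (by omega) (by omega)
  by_cases hc0 : 2 ≤ c 0
  · have hpos : ∀ i ≤ N, 0 < c i → i = 0 ∨ i = 1 := fun i hi hci => by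
      by_contra! hne
      rcases lt_or_eq_of_le hi with hi' | rfl
      · exact hne.2 (f3 i hc0 (by omega) hi' hci)
      · exact h5 (by omega) hc0 hci
    have hcN : ∀ i ≤ N, i ≠ 0 → c i ≤ 1 := fun i hi hi0 => by
      by_cases hiN : i = N
      · subst hiN
        by_contra! hci
        by_cases hN1 : i = 1
        · exact h6 hN1 hc0 hci
        · exact h5 (by omega) hc0 (by omega)
      · exact hc i hi hi0 hiN
    refine ⟨⟨1, le_rfl, hN, fun i hi hci => ?_, fun i hi => ?_⟩,
      ⟨0, 0, le_rfl, by omega, fun k _ _ => by omega, fun k hk hk' => h4 k hc0 hk hk',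
        fun i hi hci => ?_, fun i hi => ?_⟩⟩
    · have := hpos i hi hci; omega
    · by_cases hi0 : i = 0
      · subst hi0; omega
      · exact Or.inl (hcN i hi hi0)
    · have := hpos i hi hci; omega
    · by_cases hi0 : i = 0
      · subst hi0; omega
      · exact Or.inl (hcN i hi hi0)
  by_cases hcN : 2 ≤ c N
  · have hpos : ∀ i ≤ N, 0 < c i → i = N ∨ i + 1 = N := fun i hi hci => by
      by_contra! hne
      by_cases hi0 : i = 0
      · subst hi0
        exact h5' (by omega) hcN hci
      · exact hne.2 (f3' i hcN (by omega) (by omega) hci)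
    have hc' : ∀ i ≤ N, i ≠ N → c i ≤ 1 := fun i hi hiN => by
      by_cases hi0 : i = 0
      · subst hi0; omega
      · exact hc i hi hi0 hiN
    refine ⟨⟨N, hN, le_rfl, fun i hi hci => ?_, fun i hi => ?_⟩,
      ⟨N, N, le_rfl, le_rfl, fun k hk hk' => h4' k hcN hk hk', fun k _ _ => by omega,
        fun i hi hci => ?_, fun i hi => ?_⟩⟩
    · have := hpos i hi hci; omega
    · by_cases hiN : i = N
      · subst hiN; omega
      · exact Or.inl (hc' i hi hiN)
    · have := hpos i hi hci; omega
    · by_cases hiN : i = N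
      · subst hiN; omega
      · exact Or.inl (hc' i hi hiN)
  have hc1 : ∀ i ≤ N, c i ≤ 1 := fun i hi => by
    by_cases hi0 : i = 0
    · subst hi0; omega
    by_cases hiN : i = N
    · subst hiN; omega
    exact hc i hi hi0 hiN
  by_cases hI : ∃ i, 0 < i ∧ i < N ∧ 0 < c i
  swap
  · push Not at hI
    have hpos : ∀ i ≤ N, 0 < c i → i = 0 ∨ i = N := fun i hi hci => by
      by_contra! hne
      have := hI i (by omega) (by omega)
      omega
    exact ⟨⟨1, le_rfl, hN, fun i hi hci => by have := hpos i hi hci; omega,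
        fun i hi => Or.inl (hc1 i hi)⟩,
      ⟨0, N, by omega, le_rfl, fun _ _ _ => by omega, fun _ _ _ => by omega,
        fun i hi hci => by have := hpos i hi hci; omega, fun i hi => Or.inl (hc1 i hi)⟩⟩
  -- `i` is the first inner position with a pendant vertex
  obtain ⟨i, hi0, hiN, hci, hin⟩ : ∃ i, 0 < i ∧ i < N ∧ 0 < c i ∧
      ∀ j ≤ N, 0 < c j → j = 0 ∨ j = N ∨ j = i ∨ j = i + 1 := by
    classical
    refine ⟨Nat.find hI, (Nat.find_spec hI).1, (Nat.find_spec hI).2.1, (Nat.find_spec hI).2.2,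
      fun j hj hcj => ?_⟩
    by_contra! hne
    have hj' : 0 < j ∧ j < N ∧ 0 < c j := ⟨by omega, by omega, hcj⟩
    have := Nat.find_min' hI hj'
    have := f2 _ j (Nat.find_spec hI).1 (by omega) hj'.2.1 (Nat.find_spec hI).2.2 hcj
    omega
  refine ⟨⟨i + 1, by omega, hiN, fun j hj hcj => ?_, fun j hj => Or.inl (hc1 j hj)⟩, ?_⟩
  · have := hin j hj hcj; omega
  -- the three separations that are possible
  have optA : ∀ s, s ≤ N → (∀ k, 0 < k → k < s → ¬ K k) →
      (∀ j ≤ N, 0 < c j → j + 1 = s ∨ j = s ∨ j = N) →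
      ∃ s t, s ≤ t ∧ t ≤ N ∧ (∀ k, 0 < k → k < s → ¬ K k) ∧ (∀ k, t < k → k < N → ¬ K k) ∧
      (∀ i ≤ N, 0 < c i → i + 1 = s ∨ i = s ∨ i = t ∨ i = t + 1) ∧
      ∀ i ≤ N, c i ≤ 1 ∨ (c i ≤ 2 ∧ i = s ∧ s = t) := fun s hs hL hp =>
    ⟨s, N, hs, le_rfl, hL, fun _ _ _ => by omega, fun j hj hcj => by
      have := hp j hj hcj; omega, fun j hj => Or.inl (hc1 j hj)⟩
  have optB : (∀ k, i < k → k < N → ¬ K k) → (∀ j ≤ N, 0 < c j → j = 0 ∨ j = i ∨ j = i + 1) →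
      ∃ s t, s ≤ t ∧ t ≤ N ∧ (∀ k, 0 < k → k < s → ¬ K k) ∧ (∀ k, t < k → k < N → ¬ K k) ∧
      (∀ i ≤ N, 0 < c i → i + 1 = s ∨ i = s ∨ i = t ∨ i = t + 1) ∧
      ∀ i ≤ N, c i ≤ 1 ∨ (c i ≤ 2 ∧ i = s ∧ s = t) := fun hR hp =>
    ⟨0, i, by omega, hiN.le, fun _ _ _ => by omega, hR, fun j hj hcj => by
      have := hp j hj hcj; omega, fun j hj => Or.inl (hc1 j hj)⟩
  have optC : (∀ k, 0 < k → k < i → ¬ K k) → (∀ k, i + 1 < k → k < N → ¬ K k) →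
      (∀ j ≤ N, 0 < c j → j + 1 = i ∨ j = i ∨ j = i + 1 ∨ j = i + 2) →
      ∃ s t, s ≤ t ∧ t ≤ N ∧ (∀ k, 0 < k → k < s → ¬ K k) ∧ (∀ k, t < k → k < N → ¬ K k) ∧
      (∀ i ≤ N, 0 < c i → i + 1 = s ∨ i = s ∨ i = t ∨ i = t + 1) ∧
      ∀ i ≤ N, c i ≤ 1 ∨ (c i ≤ 2 ∧ i = s ∧ s = t) := fun hL hR hp =>
    ⟨i, i + 1, by omega, hiN, hL, hR, fun j hj hcj => by
      have := hp j hj hcj; omega, fun j hj => Or.inl (hc1 j hj)⟩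
  have hLR : ∀ j, 0 < c j → (∀ k, 0 < k → k < j → ¬ K k) ∨ (∀ k, j < k → k < N → ¬ K k) := by
    intro j hcj
    by_contra! hcon
    obtain ⟨⟨k, hk0, hk, hKk⟩, l, hl, hlN, hKl⟩ := hcon
    exact h1 j k l hcj hk0 hk hKk hl hlN hKl
  have hpos : ∀ P : ℕ → Prop, (0 < c 0 → P 0) → (0 < c N → P N) → P i →
      (i + 1 < N → 0 < c (i + 1) → P (i + 1)) → ∀ j ≤ N, 0 < c j → P j := by
    intro P p0 pN pi pi1 j hj hcj
    by_cases hj0 : j = 0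
    · subst hj0; exact p0 hcj
    by_cases hjN : j = N
    · subst hjN; exact pN hcj
    rcases hin j hj hcj with rfl | rfl | rfl | rfl
    · exact absurd rfl hj0
    · exact absurd rfl hjN
    · exact pi
    · exact pi1 (by omega) hcj
  by_cases hd : i + 1 < N ∧ 0 < c (i + 1)
  · rcases Nat.eq_zero_or_pos (c 0) with z0 | z0 <;> rcases Nat.eq_zero_or_pos (c N) with zN | zN
    · rcases hLR i hci with hL | hR
      · rcases hLR (i + 1) hd.2 with hL' | hR'
        · exact optA (i + 1) hd.1.le hL' (hpos _ (by omega) (by omega) (by omega) (by omega))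
        · exact optC hL hR' (hpos _ (by omega) (by omega) (by omega) (by omega))
      · exact optB hR (hpos _ (by omega) (by omega) (by omega) (by omega))
    · by_cases hi' : i + 2 < N
      · exact optA (i + 1) hd.1.le (fun k h1 h3 h4 => h2' (i + 1) k zN hi' hd.2 h1 h3 h4)
          (hpos _ (by omega) (by omega) (by omega) (by omega))
      · exact optC (fun k h1 h3 h4 => h2' i k zN hd.1 hci h1 h3 h4) (fun k _ _ => by omega)
          (hpos _ (by omega) (by omega) (by omega) (by omega))
    · by_cases hi' : 1 < i
      · exact optB (fun k h1 h3 h4 => h2 i k z0 hi' hci h1 h3 h4)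
          (hpos _ (by omega) (by omega) (by omega) (by omega))
      · exact optC (fun k _ _ => by omega)
          (fun k h1 h3 h4 => h2 (i + 1) k z0 (by omega) hd.2 h1 h3 h4)
          (hpos _ (by omega) (by omega) (by omega) (by omega))
    · have hi1 : i = 1 := by
        by_contra hne
        exact h3 i (by omega) hd.1 z0 zN hci
      have hiN' : i + 2 = N := by
        by_contra hne
        exact h3 (i + 1) (by omega) (by omega) z0 zN hd.2
      exact optC (fun k _ _ => by omega) (fun k _ _ => by omega)
        (hpos _ (by omega) (by omega) (by omega) (by omega))
  · rcases Nat.eq_zero_or_pos (c 0) with z0 | z0 <;> rcases Nat.eq_zero_or_pos (c N) with zN | zN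
    · rcases hLR i hci with hL | hR
      · exact optA i hiN.le hL (hpos _ (by omega) (by omega) (by omega) (by omega))
      · exact optB hR (hpos _ (by omega) (by omega) (by omega) (by omega))
    · by_cases hi' : i + 1 < N
      · exact optA i hiN.le (fun k h1 h3 h4 => h2' i k zN hi' hci h1 h3 h4)
          (hpos _ (by omega) (by omega) (by omega) (by omega))
      · exact optB (fun k _ _ => by omega) (hpos _ (by omega) (by omega) (by omega) (by omega))
    · by_cases hi' : 1 < i
      · exact optB (fun k h1 h3 h4 => h2 i k z0 hi' hci h1 h3 h4)
          (hpos _ (by omega) (by omega) (by omega) (by omega))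
      · exact optA i hiN.le (fun k _ _ => by omega)
          (hpos _ (by omega) (by omega) (by omega) (by omega))
    · by_cases hi' : 1 < i
      · by_cases hi'' : i + 1 < N
        · exact absurd (h3 i hi' hi'' z0 zN hci) id
        · exact optB (fun k _ _ => by omega) (hpos _ (by omega) (by omega) (by omega) (by omega))
      · exact optA i hiN.le (fun k _ _ => by omega)
          (hpos _ (by omega) (by omega) (by omega) (by omega))

theorem IsPendantFan.exists_separation {V : Type u} [Fintype V] [DecidableEq V]
    {G : SimpleGraph V} {u v : V} {N : ℕ} {w : ℕ → V} (h : IsPendantFan G u v N w)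
    (hM : maxMult G ≤ 2) :
    (∃ r, 1 ≤ r ∧ r ≤ N ∧
      (∀ i ≤ N, 0 < (pendants G (w i)).card → i = 0 ∨ i + 1 = r ∨ i = r ∨ i = N) ∧
      ∀ i ≤ N, (pendants G (w i)).card ≤ 1 ∨
        ((pendants G (w i)).card ≤ 2 ∧ ((i = 0 ∧ r = 1) ∨ (i = N ∧ r = N)))) ∧
    (∃ s t, s ≤ t ∧ t ≤ N ∧ (∀ k, 0 < k → k < s → ¬ G.Adj u (w k)) ∧
      (∀ k, t < k → k < N → ¬ G.Adj u (w k)) ∧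
      (∀ i ≤ N, 0 < (pendants G (w i)).card → i + 1 = s ∨ i = s ∨ i = t ∨ i = t + 1) ∧
      ∀ i ≤ N, (pendants G (w i)).card ≤ 1 ∨
        ((pendants G (w i)).card ≤ 2 ∧ i = s ∧ s = t)) := by
  have hr := h.reverse
  have hsub : ∀ {i}, i ≤ N → N - (N - i) = i := fun hi => Nat.sub_sub_self hi
  have hcr : ∀ {i m}, i ≤ N → m < (pendants G (w i)).card →
      m < (pendants G (w (N - (N - i)))).card := fun hi hc => by rwa [hsub hi]
  have hKr : ∀ {k}, k ≤ N → G.Adj u (w k) → G.Adj u (w (N - (N - k))) := fun hk hc => by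
    rwa [hsub hk]
  have hN0 : ∀ {m}, m < (pendants G (w N)).card → m < (pendants G (w (N - 0))).card :=
    fun hc => hc
  have h0N : ∀ {m}, m < (pendants G (w 0)).card → m < (pendants G (w (N - N))).card :=
    fun hc => by rwa [Nat.sub_self]
  refine _root_.exists_separation (c := fun i => (pendants G (w i)).card)
    (K := fun i => G.Adj u (w i)) h.fan.one_le (h.card_pendants_zero_le hM)
    (hr.card_pendants_zero_le hM) (fun i => h.card_pendants_le_one hM)
    (fun i j => h.consecutive_of_pendants hM) (fun i => h.eq_one_of_two_pendants hM)
    (fun i h1 h2 h3 h4 => ?_) (fun i k l => h.not_chords_both_sides hM)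
    (fun i k => h.not_chord_of_pendants hM) (fun i k h1 h2 h3 h4 h5 h6 => ?_)
    (fun i => h.not_pendants_ends_and_inner hM)
    (fun k => h.not_chord_of_two_pendants hM) (fun k h1 h2 h3 h4 => ?_)
    (h.not_three_end_pendants hM) (fun h1 h2 h3 => ?_) (h.not_four_end_pendants hM)
  · have := hr.eq_one_of_two_pendants hM (i := N - i) (hN0 h1) (by omega) (by omega)
      (hcr h3.le h4)
    omega
  · exact hr.not_chord_of_pendants hM (i := N - i) (k := N - k) (hN0 h1) (by omega)
      (hcr (by omega) h3) (by omega) (by omega) (hKr (by omega) h6)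
  · exact hr.not_chord_of_two_pendants hM (k := N - k) (hN0 h1) (by omega) (by omega)
      (hKr (by omega) h4)
  · exact hr.not_three_end_pendants hM h1 (hN0 h2) (h0N h3)

/-! ### Two parallel paths in a fan with pendant vertices -/

/-- The relation `P x n`, read as `x` has label `n`, numbers some of the vertices of `G`
consecutively along an induced path. Labels are integers, so that a path can be extended at either
end without renumbering. -/
structure IsPathLabelling {V : Type u} (G : SimpleGraph V) (P : V → ℤ → Prop) : Prop where
  eq_of_label : ∀ x y n, P x n → P y n → x = y
  label_unique : ∀ x n m, P x n → P x m → n = m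
  adj_iff : ∀ x y n m, P x n → P y m → (G.Adj x y ↔ n = m + 1 ∨ m = n + 1)
  exists_succ : ∀ x y n m, P x n → P y m → n < m → ∃ z, P z (n + 1)

theorem IsPathLabelling.exists_enumeration {V : Type u} [Finite V] {G : SimpleGraph V}
    {P : V → ℤ → Prop} (h : IsPathLabelling G P) (hne : ∃ x n, P x n) :
    ∃ (k : ℕ) (a : ℤ) (f : Fin k → V), 1 ≤ k ∧ (∀ i : Fin k, P (f i) (a + i)) ∧
      ∀ x n, P x n → ∃ i, f i = x := by
  classical
  let L : Set ℤ := {n | ∃ x, P x n}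
  have hfin : L.Finite := by
    refine (Set.finite_range fun x => if hx : ∃ n, P x n then hx.choose else 0).subset ?_
    rintro n ⟨x, hx⟩
    have hx' : ∃ n, P x n := ⟨n, hx⟩
    refine ⟨x, ?_⟩
    simp only [dif_pos hx']
    exact h.label_unique x _ _ hx'.choose_spec hx
  have hLne : L.Nonempty := let ⟨x, n, hx⟩ := hne; ⟨n, x, hx⟩
  obtain ⟨a, ⟨xa, hxa⟩, ha⟩ := Set.exists_min_image L id hfin hLne
  obtain ⟨b, ⟨xb, hxb⟩, hb⟩ := Set.exists_max_image L id hfin hLne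
  have hab : a ≤ b := ha b ⟨xb, hxb⟩
  have key : ∀ i : ℕ, a + i ≤ b → ∃ x, P x (a + i) := by
    intro i
    induction i with
    | zero => exact fun _ => ⟨xa, by simpa using hxa⟩
    | succ i ih =>
      intro hi
      push_cast at hi ⊢
      obtain ⟨x, hx⟩ := ih (by omega)
      obtain ⟨z, hz⟩ := h.exists_succ x xb _ _ hx hxb (by omega)
      exact ⟨z, by rwa [← add_assoc]⟩
  have key' : ∀ i : Fin (b - a + 1).toNat, ∃ x, P x (a + i) := fun i => key i (by
    have := i.2
    omega)
  choose f hf using key'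
  refine ⟨_, a, f, by omega, hf, fun x n hx => ?_⟩
  have h1 : a ≤ n := ha n ⟨x, hx⟩
  have h2 : n ≤ b := hb n ⟨x, hx⟩
  refine ⟨⟨(n - a).toNat, by omega⟩, h.eq_of_label _ _ n ?_ hx⟩
  have := hf ⟨(n - a).toNat, by omega⟩
  rwa [show a + (((n - a).toNat : ℕ) : ℤ) = n by omega] at this

theorem isTwoParallelPaths_of_labellings {V : Type u} [Finite V] {G : SimpleGraph V} {W : Set V}
    {P Q : V → ℤ → Prop} (hW : ¬ IsPathGraph (G.induce W)) (hP : IsPathLabelling G P)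
    (hQ : IsPathLabelling G Q) (hPW : ∀ x n, P x n → x ∈ W) (hQW : ∀ x n, Q x n → x ∈ W)
    (hPne : ∃ x n, P x n) (hQne : ∃ x n, Q x n)
    (hcov : ∀ x ∈ W, (∃ n, P x n) ∨ ∃ n, Q x n) (hdisj : ∀ x n m, P x n → Q x m → False)
    (hcross : ∀ x x' y y' n n' m m', P x n → P x' n' → Q y m → Q y' m' → G.Adj x y →
      G.Adj x' y' → n < n' → m ≤ m') :
    IsTwoParallelPaths (G.induce W) := by
  have emb : ∀ (R : V → ℤ → Prop), IsPathLabelling G R → (hRW : ∀ x n, R x n → x ∈ W) →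
      (∃ x n, R x n) → ∃ (k : ℕ) (a : ℤ) (p : SimpleGraph.pathGraph k ↪g G.induce W), 1 ≤ k ∧
        (∀ i : Fin k, R (p i) (a + i)) ∧ ∀ x n, R x n → ∃ i, (p i : V) = x := by
    intro R hR hRW hne
    obtain ⟨k, a, f, hk, hf, hf'⟩ := hR.exists_enumeration hne
    refine ⟨k, a, ⟨⟨fun i => ⟨f i, hRW _ _ (hf i)⟩, fun i j hij => ?_⟩, fun {i j} => ?_⟩, hk, hf,
      hf'⟩
    · have h1 : f i = f j := congrArg Subtype.val hij
      have h2 := hR.label_unique _ _ _ (hf i) (h1 ▸ hf j)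
      exact Fin.ext (by omega)
    · have h1 := hR.adj_iff _ _ _ _ (hf i) (hf j)
      rw [SimpleGraph.pathGraph_adj]
      refine h1.trans ?_
      omega
  obtain ⟨k, a, p, hk, hp, hp'⟩ := emb P hP hPW hPne
  obtain ⟨l, b, q, hl, hq, hq'⟩ := emb Q hQ hQW hQne
  refine ⟨hW, k, l, p, q, hk, hl, ?_, ?_, fun i i' j j' hii h1 h2 => ?_⟩
  · rw [Set.disjoint_left]
    rintro _ ⟨i, rfl⟩ ⟨j, hj⟩
    exact hdisj _ _ _ (hp i) (hj ▸ hq j)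
  · refine Set.eq_univ_of_forall fun x => ?_
    rcases hcov x x.2 with ⟨n, hn⟩ | ⟨n, hn⟩
    · obtain ⟨i, hi⟩ := hp' x n hn
      exact Or.inl ⟨i, Subtype.ext hi⟩
    · obtain ⟨i, hi⟩ := hq' x n hn
      exact Or.inr ⟨i, Subtype.ext hi⟩
  · have := hcross _ _ _ _ _ _ _ _ (hp i) (hp i') (hq j) (hq j') h1 h2 (by
      have := Fin.lt_def.1 hii
      omega)
    rw [Fin.le_def]
    omega

/-- At most one pendant vertex for each end of the path `w a, …, w b`: the sets `PL` and `PR` hold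
those that extend the path beyond `w a` and beyond `w b`, and there are no others. -/
structure IsEndPendants {V : Type u} [Fintype V] (G : SimpleGraph V) (w : ℕ → V) (a b : ℕ)
    (PL PR : Set V) : Prop where
  left_sub : ∀ x ∈ PL, x ∈ pendants G (w a)
  right_sub : ∀ x ∈ PR, x ∈ pendants G (w b)
  left_subsingleton : PL.Subsingleton
  right_subsingleton : PR.Subsingleton
  disjoint : ∀ x ∈ PL, x ∉ PR
  cover : ∀ i x, a ≤ i → i ≤ b → x ∈ pendants G (w i) → x ∈ PL ∨ x ∈ PR

/-- The labels of the path `w a, …, w b` extended by the pendant vertices of `PL` and `PR`. -/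
def intervalLabel {V : Type u} (w : ℕ → V) (a b : ℕ) (PL PR : Set V) (x : V) (n : ℤ) : Prop :=
  (∃ i, a ≤ i ∧ i ≤ b ∧ x = w i ∧ n = i) ∨ (x ∈ PL ∧ n = a - 1) ∨ (x ∈ PR ∧ n = b + 1)

/-- The labels of the path from `w (s - 1)` down to `w 0`, through `u`, and from `w N` down to
`w (t + 1)`, extended by the pendant vertices of `w (s - 1)` and `w (t + 1)`. One of its two parts,
or both, may be missing. -/
def aroundLabel {V : Type u} [Fintype V] (G : SimpleGraph V) (u : V) (w : ℕ → V) (N s t : ℕ)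
    (x : V) (n : ℤ) : Prop :=
  (∃ i, i < s ∧ x = w i ∧ n = -i) ∨ (x = u ∧ n = 1) ∨
    (∃ i, t < i ∧ i ≤ N ∧ x = w i ∧ n = N + 2 - i) ∨
    (1 ≤ s ∧ x ∈ pendants G (w (s - 1)) ∧ n = -s) ∨
    (t < N ∧ x ∈ pendants G (w (t + 1)) ∧ n = N + 2 - t)

namespace IsPendantFan

variable {V : Type u} [Fintype V] {G : SimpleGraph V} {u v : V} {N : ℕ} {w : ℕ → V}

theorem exists_isEndPendants (h : IsPendantFan G u v N w) {a b : ℕ} (hab : a ≤ b) (hb : b ≤ N)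
    (hc : ∀ i, a ≤ i → i ≤ b → 0 < (pendants G (w i)).card → i = a ∨ i = b)
    (h1 : a < b → (pendants G (w a)).card ≤ 1 ∧ (pendants G (w b)).card ≤ 1)
    (h2 : a = b → (pendants G (w a)).card ≤ 2) :
    ∃ PL PR, IsEndPendants G w a b PL PR := by
  classical
  rcases lt_or_eq_of_le hab with hab | rfl
  · refine ⟨pendants G (w a), pendants G (w b), fun x hx => hx, fun x hx => hx,
      fun x hx y hy => Finset.card_le_one.1 (h1 hab).1 x hx y hy,
      fun x hx y hy => Finset.card_le_one.1 (h1 hab).2 x hx y hy, fun x hx hx' => ?_,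
      fun i x hi hi' hx => ?_⟩
    · have := h.pendant_unique (by omega) hx hb hx'
      omega
    · rcases hc i hi hi' (Finset.card_pos.2 ⟨x, hx⟩) with rfl | rfl
      · exact Or.inl hx
      · exact Or.inr hx
  · have h2 := h2 rfl
    rcases (pendants G (w a)).eq_empty_or_nonempty with h0 | ⟨y, hy⟩
    · refine ⟨∅, ∅, by simp, by simp, by simp, by simp, by simp, fun i x hi hi' hx => ?_⟩
      obtain rfl : i = a := by omega
      simp [h0] at hx
    · refine ⟨{y}, (pendants G (w a)).erase y, ?_, fun x hx => Finset.mem_of_mem_erase hx,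
        by simp, fun x hx z hz => ?_, ?_, fun i x hi hi' hx => ?_⟩
      · rintro x rfl; exact hy
      · refine Finset.card_le_one.1 ?_ x hx z hz
        rw [Finset.card_erase_of_mem hy]
        omega
      · rintro x rfl; simp
      · obtain rfl : i = a := by omega
        by_cases hxy : x = y
        · exact Or.inl hxy
        · exact Or.inr (Finset.mem_erase.2 ⟨hxy, hx⟩)

theorem not_adj_pendants {i j : ℕ} (h : IsPendantFan G u v N w) {x y : V} (hj : j ≤ N)
    (hx : x ∈ pendants G (w i)) (hi : i ≤ N) (hy : y ∈ pendants G (w j)) : ¬ G.Adj x y :=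
  fun hxy => h.pendant_ne hj hy hi ((pendant_adj hx _).1 hxy)

theorem adj_path_pendant {i j : ℕ} (h : IsPendantFan G u v N w) {y : V} (hi : i ≤ N) (hj : j ≤ N)
    (hy : y ∈ pendants G (w j)) : G.Adj (w i) y ↔ i = j := by
  rw [G.adj_comm, pendant_adj hy]
  exact ⟨h.fan.inj i hi j hj, fun hij => hij ▸ rfl⟩

theorem isPathLabelling_intervalLabel (h : IsPendantFan G u v N w) {a b : ℕ} (hab : a ≤ b)
    (hb : b ≤ N) {PL PR : Set V} (hP : IsEndPendants G w a b PL PR) :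
    IsPathLabelling G (intervalLabel w a b PL PR) where
  eq_of_label := by
    rintro x y n (⟨i, hi, hi', rfl, rfl⟩ | ⟨hx, rfl⟩ | ⟨hx, rfl⟩)
      (⟨j, hj, hj', rfl, h1⟩ | ⟨hy, h1⟩ | ⟨hy, h1⟩)
    · obtain rfl : i = j := by omega
      rfl
    · omega
    · omega
    · omega
    · exact hP.left_subsingleton hx hy
    · omega
    · omega
    · omega
    · exact hP.right_subsingleton hx hy
  label_unique := by
    rintro x n m (⟨i, hi, hi', rfl, rfl⟩ | ⟨hx, rfl⟩ | ⟨hx, rfl⟩)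
      (⟨j, hj, hj', h1, rfl⟩ | ⟨hy, rfl⟩ | ⟨hy, rfl⟩)
    · rw [h.fan.inj i (by omega) j (by omega) h1]
    · exact absurd rfl (h.pendant_ne (by omega) (hP.left_sub _ hy) (by omega))
    · exact absurd rfl (h.pendant_ne (by omega) (hP.right_sub _ hy) (by omega))
    · exact absurd h1 (h.pendant_ne (by omega) (hP.left_sub _ hx) (by omega))
    · rfl
    · exact absurd hy (hP.disjoint x hx)
    · exact absurd h1 (h.pendant_ne (by omega) (hP.right_sub _ hx) (by omega))
    · exact absurd hx (hP.disjoint x hy)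
    · rfl
  adj_iff := by
    rintro x y n m (⟨i, hi, hi', rfl, rfl⟩ | ⟨hx, rfl⟩ | ⟨hx, rfl⟩)
      (⟨j, hj, hj', rfl, rfl⟩ | ⟨hy, rfl⟩ | ⟨hy, rfl⟩)
    · rw [h.fan.adj_iff i (by omega) j (by omega)]; omega
    · rw [h.adj_path_pendant (by omega) (by omega) (hP.left_sub _ hy)]; omega
    · rw [h.adj_path_pendant (by omega) (by omega) (hP.right_sub _ hy)]; omega
    · rw [G.adj_comm, h.adj_path_pendant (by omega) (by omega) (hP.left_sub _ hx)]; omega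
    · exact iff_of_false (h.not_adj_pendants (by omega) (hP.left_sub _ hx) (by omega)
        (hP.left_sub _ hy)) (by omega)
    · exact iff_of_false (h.not_adj_pendants (by omega) (hP.left_sub _ hx) (by omega)
        (hP.right_sub _ hy)) (by omega)
    · rw [G.adj_comm, h.adj_path_pendant (by omega) (by omega) (hP.right_sub _ hx)]; omega
    · exact iff_of_false (h.not_adj_pendants (by omega) (hP.right_sub _ hx) (by omega)
        (hP.left_sub _ hy)) (by omega)
    · exact iff_of_false (h.not_adj_pendants (by omega) (hP.right_sub _ hx) (by omega)
        (hP.right_sub _ hy)) (by omega)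
  exists_succ := by
    rintro x y n m (⟨i, hi, hi', rfl, rfl⟩ | ⟨hx, rfl⟩ | ⟨hx, rfl⟩) hy hnm
    · by_cases hib : i = b
      · rcases hy with ⟨j, hj, hj', rfl, rfl⟩ | ⟨hy, rfl⟩ | ⟨hy, rfl⟩
        · omega
        · omega
        · exact ⟨y, Or.inr (Or.inr ⟨hy, by omega⟩)⟩
      · exact ⟨w (i + 1), Or.inl ⟨i + 1, by omega, by omega, rfl, by push_cast; rfl⟩⟩
    · exact ⟨w a, Or.inl ⟨a, le_rfl, hab, rfl, by omega⟩⟩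
    · rcases hy with ⟨j, hj, hj', rfl, rfl⟩ | ⟨hy, rfl⟩ | ⟨hy, rfl⟩ <;> omega

theorem isPathLabelling_aroundLabel (h : IsPendantFan G u v N w) {s t : ℕ} (hst : s ≤ t)
    (ht : t ≤ N) (hL : ∀ k, 0 < k → k < s → ¬ G.Adj u (w k))
    (hR : ∀ k, t < k → k < N → ¬ G.Adj u (w k))
    (hcs : 1 ≤ s → (pendants G (w (s - 1))).card ≤ 1)
    (hct : t < N → (pendants G (w (t + 1))).card ≤ 1) :
    IsPathLabelling G (aroundLabel G u w N s t) := by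
  have hu0 : ∀ i, i < s → (G.Adj u (w i) ↔ i = 0) := fun i hi =>
    ⟨fun h1 => by
      by_contra h0
      exact hL i (by omega) hi h1, fun h1 => h1 ▸ h.fan.adj_zero⟩
  have huN : ∀ i, t < i → i ≤ N → (G.Adj u (w i) ↔ i = N) := fun i hi hi' =>
    ⟨fun h1 => by
      by_contra h0
      exact hR i hi (by omega) h1, fun h1 => h1 ▸ h.fan.adj_last⟩
  have hup : ∀ i x, i ≤ N → x ∈ pendants G (w i) → ¬ G.Adj u x := fun i x hi hx h1 =>
    h.fan.ne_center i hi ((pendant_adj hx _).1 h1.symm).symm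
  have hsymm : ∀ x y n m, aroundLabel G u w N s t x n → aroundLabel G u w N s t y m → n ≤ m →
      (G.Adj x y ↔ m = n + 1) := by
    rintro x y n m (⟨i, hi, rfl, rfl⟩ | ⟨rfl, rfl⟩ | ⟨i, hi, hi', rfl, rfl⟩ | ⟨hs, hx, rfl⟩ |
      ⟨ht', hx, rfl⟩) (⟨j, hj, rfl, rfl⟩ | ⟨rfl, rfl⟩ | ⟨j, hj, hj', rfl, rfl⟩ | ⟨hs', hy, rfl⟩ |
      ⟨ht', hy, rfl⟩) hnm
    · rw [h.fan.adj_iff i (by omega) j (by omega)]; omega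
    · rw [G.adj_comm, hu0 i hi]; omega
    · rw [h.fan.adj_iff i (by omega) j (by omega)]; omega
    · rw [h.adj_path_pendant (by omega) (by omega) hy]; omega
    · rw [h.adj_path_pendant (by omega) (by omega) hy]; omega
    · omega
    · exact iff_of_false G.irrefl (by omega)
    · rw [huN j hj hj']; omega
    · omega
    · exact iff_of_false (hup _ _ (by omega) hy) (by omega)
    · omega
    · omega
    · rw [h.fan.adj_iff i (by omega) j (by omega)]; omega
    · omega
    · rw [h.adj_path_pendant (by omega) (by omega) hy]; omega
    · rw [G.adj_comm, h.adj_path_pendant (by omega) (by omega) hx]; omega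
    · rw [G.adj_comm]
      exact iff_of_false (hup _ _ (by omega) hx) (by omega)
    · rw [G.adj_comm, h.adj_path_pendant (by omega) (by omega) hx]; omega
    · exact iff_of_false (h.not_adj_pendants (by omega) hx (by omega) hy) (by omega)
    · exact iff_of_false (h.not_adj_pendants (by omega) hx (by omega) hy) (by omega)
    · omega
    · omega
    · omega
    · omega
    · exact iff_of_false (h.not_adj_pendants (by omega) hx (by omega) hy) (by omega)
  refine ⟨?_, ?_, fun x y n m hx hy => ?_, ?_⟩
  · rintro x y n (⟨i, hi, rfl, rfl⟩ | ⟨rfl, rfl⟩ | ⟨i, hi, hi', rfl, rfl⟩ | ⟨hs, hx, rfl⟩ |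
      ⟨ht', hx, rfl⟩) (⟨j, hj, rfl, h1⟩ | ⟨rfl, h1⟩ | ⟨j, hj, hj', rfl, h1⟩ | ⟨hs', hy, h1⟩ |
      ⟨ht', hy, h1⟩) <;> try omega
    · obtain rfl : i = j := by omega
      rfl
    · rfl
    · obtain rfl : i = j := by omega
      rfl
    · exact Finset.card_le_one.1 (hcs hs) x hx y hy
    · exact Finset.card_le_one.1 (hct ht') x hx y hy
  · rintro x n m (⟨i, hi, rfl, rfl⟩ | ⟨rfl, rfl⟩ | ⟨i, hi, hi', rfl, rfl⟩ | ⟨hs, hx, rfl⟩ |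
      ⟨ht', hx, rfl⟩) (⟨j, hj, h1, rfl⟩ | ⟨h1, rfl⟩ | ⟨j, hj, hj', h1, rfl⟩ | ⟨hs', hy, rfl⟩ |
      ⟨ht', hy, rfl⟩)
    · rw [h.fan.inj i (by omega) j (by omega) h1]
    · exact absurd h1 (h.fan.ne_center i (by omega))
    · have := h.fan.inj i (by omega) j (by omega) h1
      omega
    · exact absurd rfl (h.pendant_ne (by omega) hy (by omega))
    · exact absurd rfl (h.pendant_ne (by omega) hy (by omega))
    · exact absurd h1.symm (h.fan.ne_center j (by omega))
    · rfl
    · exact absurd h1.symm (h.fan.ne_center j (by omega))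
    · exact absurd rfl (h.pendant_ne_center hy)
    · exact absurd rfl (h.pendant_ne_center hy)
    · have := h.fan.inj i (by omega) j (by omega) h1
      omega
    · exact absurd h1 (h.fan.ne_center i (by omega))
    · rw [h.fan.inj i (by omega) j (by omega) h1]
    · exact absurd rfl (h.pendant_ne (by omega) hy (by omega))
    · exact absurd rfl (h.pendant_ne (by omega) hy (by omega))
    · exact absurd h1 (h.pendant_ne (by omega) hx (by omega))
    · exact absurd h1 (h.pendant_ne_center hx)
    · exact absurd h1 (h.pendant_ne (by omega) hx (by omega))
    · rfl
    · have := h.pendant_unique (by omega) hx (by omega) hy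
      omega
    · exact absurd h1 (h.pendant_ne (by omega) hx (by omega))
    · exact absurd h1 (h.pendant_ne_center hx)
    · exact absurd h1 (h.pendant_ne (by omega) hx (by omega))
    · have := h.pendant_unique (by omega) hx (by omega) hy
      omega
    · rfl
  · rcases le_total n m with hnm | hnm
    · rw [hsymm x y n m hx hy hnm]; omega
    · rw [G.adj_comm, hsymm y x m n hy hx hnm]; omega
  · rintro x y n m (⟨i, hi, rfl, rfl⟩ | ⟨rfl, rfl⟩ | ⟨i, hi, hi', rfl, rfl⟩ | ⟨hs, hx, rfl⟩ |
      ⟨ht', hx, rfl⟩) hy hnm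
    · by_cases hi0 : i = 0
      · exact ⟨u, Or.inr (Or.inl ⟨rfl, by omega⟩)⟩
      · exact ⟨w (i - 1), Or.inl ⟨i - 1, by omega, rfl, by omega⟩⟩
    · have htN : t < N := by
        rcases hy with ⟨j, hj, rfl, rfl⟩ | ⟨rfl, rfl⟩ | ⟨j, hj, hj', rfl, rfl⟩ | ⟨hs', hy, rfl⟩ |
          ⟨ht', hy, rfl⟩ <;> omega
      exact ⟨w N, Or.inr (Or.inr (Or.inl ⟨N, htN, le_rfl, rfl, by omega⟩))⟩
    · by_cases hit : i = t + 1
      · rcases hy with ⟨j, hj, rfl, rfl⟩ | ⟨rfl, rfl⟩ | ⟨j, hj, hj', rfl, rfl⟩ | ⟨hs', hy, rfl⟩ |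
          ⟨ht', hy, rfl⟩
        · omega
        · omega
        · omega
        · omega
        · exact ⟨y, Or.inr (Or.inr (Or.inr (Or.inr ⟨ht', hy, by omega⟩)))⟩
      · exact ⟨w (i - 1), Or.inr (Or.inr (Or.inl ⟨i - 1, by omega, by omega, rfl, by omega⟩))⟩
    · exact ⟨w (s - 1), Or.inl ⟨s - 1, by omega, rfl, by omega⟩⟩
    · rcases hy with ⟨j, hj, rfl, rfl⟩ | ⟨rfl, rfl⟩ | ⟨j, hj, hj', rfl, rfl⟩ | ⟨hs', hy, rfl⟩ |
          ⟨ht', hy, rfl⟩ <;> omega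

/-- Along a path graph, the last vertex of the fan would have two neighbours in the fan before
it. -/
theorem not_isPathGraph_of_fan {S W : Set V} (h : IsFan G u S N w) (hSW : S ⊆ W) :
    ¬ IsPathGraph (G.induce W) := by
  rintro ⟨n, -, ⟨e⟩⟩
  have hN := h.one_le
  have hdeg : ∀ x ∈ S, ∃ y ∈ S, ∃ z ∈ S, y ≠ z ∧ G.Adj x y ∧ G.Adj x z := by
    intro x hx
    rcases (h.mem_iff x).1 hx with rfl | ⟨i, hi, rfl⟩
    · refine ⟨w 0, h.mem (by omega), w N, h.mem le_rfl, fun h0 => ?_, h.adj_zero, h.adj_last⟩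
      have := h.inj 0 (by omega) N le_rfl h0
      omega
    by_cases h0 : i = 0
    · subst h0
      exact ⟨u, h.center_mem, w 1, h.mem hN, (h.ne_center 1 hN).symm, h.adj_zero.symm,
        (h.adj_iff 0 (by omega) 1 hN).2 (by omega)⟩
    by_cases hiN : i = N
    · subst hiN
      exact ⟨u, h.center_mem, w (i - 1), h.mem (by omega), (h.ne_center _ (by omega)).symm,
        h.adj_last.symm, (h.adj_iff i le_rfl (i - 1) (by omega)).2 (by omega)⟩
    refine ⟨w (i - 1), h.mem (by omega), w (i + 1), h.mem (by omega), fun h1 => ?_,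
      (h.adj_iff i hi (i - 1) (by omega)).2 (by omega),
      (h.adj_iff i hi (i + 1) (by omega)).2 (by omega)⟩
    have := h.inj (i - 1) (by omega) (i + 1) (by omega) h1
    omega
  obtain ⟨x, hx, hmax⟩ := Set.exists_max_image {x : W | (x : V) ∈ S} (fun x => e x)
    (Set.toFinite _) ⟨⟨u, hSW h.center_mem⟩, h.center_mem⟩
  obtain ⟨y, hy, z, hz, hyz, hxy, hxz⟩ := hdeg x hx
  have key : ∀ y (hy : y ∈ S), G.Adj x y → (e ⟨y, hSW hy⟩).val + 1 = (e x).val := by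
    intro y hy hxy
    have h1 : (SimpleGraph.pathGraph n).Adj (e x) (e ⟨y, hSW hy⟩) := e.map_adj_iff.2 hxy
    have h2 : e ⟨y, hSW hy⟩ ≤ e x := hmax ⟨y, hSW hy⟩ hy
    rw [SimpleGraph.pathGraph_adj] at h1
    rw [Fin.le_def] at h2
    omega
  have h1 := key y hy hxy
  have h2 := key z hz hxz
  have h3 : e ⟨y, hSW hy⟩ = e ⟨z, hSW hz⟩ := Fin.ext (by omega)
  exact hyz (congrArg Subtype.val (e.injective h3))

theorem isTwoParallelPaths_compl_v (h : IsPendantFan G u v N w) {s t : ℕ} (hst : s ≤ t)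
    (ht : t ≤ N) (hL : ∀ k, 0 < k → k < s → ¬ G.Adj u (w k))
    (hR : ∀ k, t < k → k < N → ¬ G.Adj u (w k))
    (hpos : ∀ i ≤ N, 0 < (pendants G (w i)).card → i + 1 = s ∨ i = s ∨ i = t ∨ i = t + 1)
    (hc : ∀ i ≤ N, (pendants G (w i)).card ≤ 1 ∨
      ((pendants G (w i)).card ≤ 2 ∧ i = s ∧ s = t)) :
    IsTwoParallelPaths (G.induce ({v}ᶜ : Set V)) := by
  have hpath : ¬ IsPathGraph (G.induce ({v}ᶜ : Set V)) := by
    refine not_isPathGraph_of_fan h.fan ?_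
    rintro x (rfl | ⟨i, hi, rfl⟩)
    · exact h.v_ne_u.symm
    · exact (h.v_ne hi).symm
  obtain ⟨PL, PR, hP⟩ := h.exists_isEndPendants hst ht
    (fun i h1 h2 h3 => by have := hpos i (by omega) h3; omega)
    (fun h1 => by have := hc s (by omega); have := hc t ht; omega)
    (fun h1 => by have := hc s (by omega); omega)
  have hcs : 1 ≤ s → (pendants G (w (s - 1))).card ≤ 1 := fun h1 => by
    have := hc (s - 1) (by omega); omega
  have hct : t < N → (pendants G (w (t + 1))).card ≤ 1 := fun h1 => by
    have := hc (t + 1) (by omega); omega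
  -- the edges between the two paths
  have hadj : ∀ x y n m, intervalLabel w s t PL PR x n → aroundLabel G u w N s t y m →
      G.Adj x y → (n = s ∧ m = 1 - s ∧ 1 ≤ s) ∨ (m = 1 ∧ s ≤ n ∧ n ≤ t) ∨
        (n = t ∧ m = N + 1 - t ∧ t < N) := by
    rintro x y n m (⟨i, hi, hi', rfl, rfl⟩ | ⟨hx, rfl⟩ | ⟨hx, rfl⟩) (⟨j, hj, rfl, rfl⟩ | ⟨rfl, rfl⟩
      | ⟨j, hj, hj', rfl, rfl⟩ | ⟨hs', hy, rfl⟩ | ⟨ht', hy, rfl⟩) hxy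
    · rw [h.fan.adj_iff i (by omega) j (by omega)] at hxy; omega
    · omega
    · rw [h.fan.adj_iff i (by omega) j (by omega)] at hxy; omega
    · rw [h.adj_path_pendant (by omega) (by omega) hy] at hxy; omega
    · rw [h.adj_path_pendant (by omega) (by omega) hy] at hxy; omega
    · rw [G.adj_comm, h.adj_path_pendant (by omega) (by omega) (hP.left_sub _ hx)] at hxy; omega
    · exact absurd ((pendant_adj (hP.left_sub _ hx) _).1 hxy).symm (h.fan.ne_center s (by omega))
    · rw [G.adj_comm, h.adj_path_pendant (by omega) (by omega) (hP.left_sub _ hx)] at hxy; omega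
    · exact absurd hxy (h.not_adj_pendants (by omega) (hP.left_sub _ hx) (by omega) hy)
    · exact absurd hxy (h.not_adj_pendants (by omega) (hP.left_sub _ hx) (by omega) hy)
    · rw [G.adj_comm, h.adj_path_pendant (by omega) (by omega) (hP.right_sub _ hx)] at hxy; omega
    · exact absurd ((pendant_adj (hP.right_sub _ hx) _).1 hxy).symm (h.fan.ne_center t (by omega))
    · rw [G.adj_comm, h.adj_path_pendant (by omega) (by omega) (hP.right_sub _ hx)] at hxy; omega
    · exact absurd hxy (h.not_adj_pendants (by omega) (hP.right_sub _ hx) (by omega) hy)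
    · exact absurd hxy (h.not_adj_pendants (by omega) (hP.right_sub _ hx) (by omega) hy)
  refine isTwoParallelPaths_of_labellings hpath (h.isPathLabelling_intervalLabel hst ht hP)
    (h.isPathLabelling_aroundLabel hst ht hL hR hcs hct) ?_ ?_
    ⟨w s, s, Or.inl ⟨s, le_rfl, hst, rfl, rfl⟩⟩ ⟨u, 1, Or.inr (Or.inl ⟨rfl, rfl⟩)⟩
    (fun x hx => ?_) ?_ ?_
  · rintro x n (⟨i, hi, hi', rfl, rfl⟩ | ⟨hx, rfl⟩ | ⟨hx, rfl⟩)
    · exact (h.v_ne (by omega)).symm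
    · exact h.pendant_ne_v (by omega) (hP.left_sub _ hx)
    · exact h.pendant_ne_v (by omega) (hP.right_sub _ hx)
  · rintro x n (⟨j, hj, rfl, rfl⟩ | ⟨rfl, rfl⟩ | ⟨j, hj, hj', rfl, rfl⟩ | ⟨hs', hy, rfl⟩ |
      ⟨ht', hy, rfl⟩)
    · exact (h.v_ne (by omega)).symm
    · exact h.v_ne_u.symm
    · exact (h.v_ne (by omega)).symm
    · exact h.pendant_ne_v (by omega) hy
    · exact h.pendant_ne_v (by omega) hy
  · rcases h.cover x with rfl | rfl | ⟨i, hi, rfl⟩ | ⟨i, hi, hx'⟩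
    · exact Or.inr ⟨1, Or.inr (Or.inl ⟨rfl, rfl⟩)⟩
    · exact absurd rfl hx
    · rcases lt_or_ge i s with h1 | h1
      · exact Or.inr ⟨_, Or.inl ⟨i, h1, rfl, rfl⟩⟩
      rcases lt_or_ge t i with h2 | h2
      · exact Or.inr ⟨_, Or.inr (Or.inr (Or.inl ⟨i, h2, hi, rfl, rfl⟩))⟩
      · exact Or.inl ⟨_, Or.inl ⟨i, h1, h2, rfl, rfl⟩⟩
    · have hci := Finset.card_pos.2 ⟨x, hx'⟩
      by_cases h1 : s ≤ i ∧ i ≤ t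
      · rcases hP.cover i x h1.1 h1.2 hx' with h3 | h3
        · exact Or.inl ⟨_, Or.inr (Or.inl ⟨h3, rfl⟩)⟩
        · exact Or.inl ⟨_, Or.inr (Or.inr ⟨h3, rfl⟩)⟩
      rcases hpos i hi hci with h2 | h2 | h2 | h2
      · exact Or.inr ⟨_, Or.inr (Or.inr (Or.inr (Or.inl ⟨by omega, by
          rwa [show s - 1 = i by omega], rfl⟩)))⟩
      · omega
      · omega
      · exact Or.inr ⟨_, Or.inr (Or.inr (Or.inr (Or.inr ⟨by omega, h2 ▸ hx', rfl⟩)))⟩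
  · rintro x n m (⟨i, hi, hi', rfl, rfl⟩ | ⟨hx, rfl⟩ | ⟨hx, rfl⟩) (⟨j, hj, h1, rfl⟩ | ⟨h1, rfl⟩
      | ⟨j, hj, hj', h1, rfl⟩ | ⟨hs', hy, rfl⟩ | ⟨ht', hy, rfl⟩)
    · have := h.fan.inj i (by omega) j (by omega) h1
      omega
    · exact h.fan.ne_center i (by omega) h1
    · have := h.fan.inj i (by omega) j (by omega) h1
      omega
    · exact h.pendant_ne (by omega) hy (by omega) rfl
    · exact h.pendant_ne (by omega) hy (by omega) rfl
    · exact h.pendant_ne (by omega) (hP.left_sub _ hx) (by omega) h1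
    · exact h.pendant_ne_center (hP.left_sub _ hx) h1
    · exact h.pendant_ne (by omega) (hP.left_sub _ hx) (by omega) h1
    · have := h.pendant_unique (by omega) (hP.left_sub _ hx) (by omega) hy
      omega
    · have := h.pendant_unique (by omega) (hP.left_sub _ hx) (by omega) hy
      omega
    · exact h.pendant_ne (by omega) (hP.right_sub _ hx) (by omega) h1
    · exact h.pendant_ne_center (hP.right_sub _ hx) h1
    · exact h.pendant_ne (by omega) (hP.right_sub _ hx) (by omega) h1
    · have := h.pendant_unique (by omega) (hP.right_sub _ hx) (by omega) hy
      omega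
    · have := h.pendant_unique (by omega) (hP.right_sub _ hx) (by omega) hy
      omega
  · intro x x' y y' n n' m m' h1 h2 h3 h4 h5 h6 h7
    have := hadj x y n m h1 h3 h5
    have := hadj x' y' n' m' h2 h4 h6
    omega

theorem isTwoParallelPaths_compl_center (h : IsPendantFan G u v N w) {r : ℕ} (hr : 1 ≤ r)
    (hrN : r ≤ N)
    (hpos : ∀ i ≤ N, 0 < (pendants G (w i)).card → i = 0 ∨ i + 1 = r ∨ i = r ∨ i = N)
    (hc : ∀ i ≤ N, (pendants G (w i)).card ≤ 1 ∨
      ((pendants G (w i)).card ≤ 2 ∧ ((i = 0 ∧ r = 1) ∨ (i = N ∧ r = N))))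
    (hpath : ¬ IsPathGraph (G.induce ({u, v}ᶜ : Set V))) :
    IsTwoParallelPaths (G.induce ({u, v}ᶜ : Set V)) := by
  obtain ⟨PL, PR, hP⟩ := h.exists_isEndPendants hrN le_rfl
    (fun i h1 h2 h3 => by have := hpos i (by omega) h3; omega)
    (fun h1 => by have := hc r (by omega); have := hc N le_rfl; omega)
    (fun h1 => by have := hc r (by omega); omega)
  obtain ⟨QL, QR, hQ⟩ := h.exists_isEndPendants (a := 0) (b := r - 1) (by omega) (by omega)
    (fun i h1 h2 h3 => by have := hpos i (by omega) h3; omega)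
    (fun h1 => by have := hc 0 (by omega); have := hc (r - 1) (by omega); omega)
    (fun h1 => by have := hc 0 (by omega); omega)
  have hW : ∀ {x}, x ≠ u → x ≠ v → x ∈ ({u, v}ᶜ : Set V) := fun h1 h2 h3 => by
    rcases h3 with h3 | h3
    exacts [h1 h3, h2 h3]
  have hsub : ∀ {a b : ℕ} {PL PR : Set V} {x n}, a ≤ b → b ≤ N → IsEndPendants G w a b PL PR →
      intervalLabel w a b PL PR x n → x ∈ ({u, v}ᶜ : Set V) := by
    rintro a b PL PR x n hab hb hP (⟨i, hi, hi', rfl, rfl⟩ | ⟨hx, rfl⟩ | ⟨hx, rfl⟩)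
    · exact hW (h.fan.ne_center i (by omega)) (h.v_ne (by omega)).symm
    · exact hW (h.pendant_ne_center (hP.left_sub _ hx))
        (h.pendant_ne_v (by omega) (hP.left_sub _ hx))
    · exact hW (h.pendant_ne_center (hP.right_sub _ hx))
        (h.pendant_ne_v (by omega) (hP.right_sub _ hx))
  -- every vertex of a labelled path is on the path of the fan or pendant there
  have hbase : ∀ {a b : ℕ} {PL PR : Set V} {x n}, a ≤ b → IsEndPendants G w a b PL PR →
      intervalLabel w a b PL PR x n → ∃ i, a ≤ i ∧ i ≤ b ∧
        ((x = w i ∧ n = i) ∨ x ∈ pendants G (w i)) := by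
    rintro a b PL PR x n hab hP (⟨i, hi, hi', rfl, rfl⟩ | ⟨hx, rfl⟩ | ⟨hx, rfl⟩)
    · exact ⟨i, hi, hi', Or.inl ⟨rfl, rfl⟩⟩
    · exact ⟨a, le_rfl, hab, Or.inr (hP.left_sub _ hx)⟩
    · exact ⟨b, hab, le_rfl, Or.inr (hP.right_sub _ hx)⟩
  have hadj : ∀ x y n m, intervalLabel w r N PL PR x n → intervalLabel w 0 (r - 1) QL QR y m →
      G.Adj x y → n = r := by
    intro x y n m hx hy hxy
    obtain ⟨i, hi, hi', hx⟩ := hbase hrN hP hx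
    obtain ⟨j, hj, hj', hy⟩ := hbase (by omega) hQ hy
    rcases hx with ⟨rfl, rfl⟩ | hx <;> rcases hy with ⟨rfl, rfl⟩ | hy
    · rw [h.fan.adj_iff i hi' j (by omega)] at hxy
      omega
    · rw [h.adj_path_pendant hi' (by omega) hy] at hxy
      omega
    · rw [G.adj_comm, h.adj_path_pendant (by omega) hi' hx] at hxy
      omega
    · exact absurd hxy (h.not_adj_pendants (by omega) hx hi' hy)
  refine isTwoParallelPaths_of_labellings hpath (h.isPathLabelling_intervalLabel hrN le_rfl hP)
    (h.isPathLabelling_intervalLabel (by omega) (by omega) hQ)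
    (fun x n => hsub hrN le_rfl hP) (fun x n => hsub (by omega) (by omega) hQ)
    ⟨w r, r, Or.inl ⟨r, le_rfl, hrN, rfl, rfl⟩⟩ ⟨w 0, 0, Or.inl ⟨0, le_rfl, by omega, rfl, rfl⟩⟩
    (fun x hx => ?_) (fun x n m hx hy => ?_) ?_
  · rcases h.cover x with rfl | rfl | ⟨i, hi, rfl⟩ | ⟨i, hi, hx'⟩
    · exact absurd (Or.inl rfl) hx
    · exact absurd (Or.inr rfl) hx
    · rcases lt_or_ge i r with h1 | h1
      · exact Or.inr ⟨_, Or.inl ⟨i, by omega, by omega, rfl, rfl⟩⟩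
      · exact Or.inl ⟨_, Or.inl ⟨i, h1, hi, rfl, rfl⟩⟩
    · rcases lt_or_ge i r with h1 | h1
      · rcases hQ.cover i x (by omega) (by omega) hx' with h2 | h2
        · exact Or.inr ⟨_, Or.inr (Or.inl ⟨h2, rfl⟩)⟩
        · exact Or.inr ⟨_, Or.inr (Or.inr ⟨h2, rfl⟩)⟩
      · rcases hP.cover i x h1 hi hx' with h2 | h2
        · exact Or.inl ⟨_, Or.inr (Or.inl ⟨h2, rfl⟩)⟩
        · exact Or.inl ⟨_, Or.inr (Or.inr ⟨h2, rfl⟩)⟩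
  · obtain ⟨i, hi, hi', hx⟩ := hbase hrN hP hx
    obtain ⟨j, hj, hj', hy⟩ := hbase (by omega) hQ hy
    rcases hx with ⟨rfl, rfl⟩ | hx <;> rcases hy with ⟨h1, rfl⟩ | hy
    · have := h.fan.inj i hi' j (by omega) h1
      omega
    · exact h.pendant_ne (by omega) hy hi' rfl
    · exact h.pendant_ne hi' hx (by omega) h1
    · have := h.pendant_unique hi' hx (by omega) hy
      omega
  · intro x x' y y' n n' m m' h1 h2 h3 h4 h5 h6 h7
    have := hadj x y n m h1 h3 h5
    have := hadj x' y' n' m' h2 h4 h6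
    omega

end IsPendantFan

/-! ### The characterization -/

/-- A vertex of degree one lies in no induced subgraph of minimum degree two. So the core is
unique: it is the complement of the set of pendant vertices. -/
theorem IsSimplePartialTwoTree.exists_isPendantFan {V : Type u} [Fintype V] {G : SimpleGraph V}
    (hG : IsSimplePartialTwoTree G) {u v : V} (hu : IsDistinguished G u)
    (hv : ∀ w, IsPendantNeighbor G u w ↔ w = v) : ∃ N w, IsPendantFan G u v N w := by
  obtain ⟨-, -, C, hC, -, hpend⟩ := hG
  obtain ⟨C', 𝒵, E, hC', hL, -, hterm⟩ := hu
  obtain rfl : C' = C := by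
    refine hC'.eq_of_le hC.prop fun x hx => ?_
    by_contra hxC
    obtain ⟨y, -, hy⟩ := hpend x hxC
    have h2 := hC'.prop.2 ⟨x, hx⟩
    obtain ⟨a, b, ha, hb, hab⟩ := Set.one_lt_encard_iff.1
      (lt_of_lt_of_le (by norm_num) h2 : 1 < ((G.induce C').neighborSet ⟨x, hx⟩).encard)
    have key : ∀ a : C', (G.induce C').Adj ⟨x, hx⟩ a → (a : V) = y := fun a ha => by
      have : (a : V) ∈ G.neighborSet x := ha
      rwa [hy] at this
    exact hab (Subtype.ext ((key a ha).trans (key b hb).symm))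
  obtain ⟨N, w, hfan, -⟩ := hL.1.exists_isFan u hterm
  have hnb : ∀ {x y : V}, G.neighborSet x = {y} → x ∈ pendants G y := fun {x y} hxy =>
    mem_pendants.2 fun z => by
      rw [← SimpleGraph.mem_neighborSet, hxy, Set.mem_singleton_iff]
  refine ⟨N, w, ?_, ?_, fun x => ?_⟩
  · rwa [show C' = {x | x = u ∨ ∃ i ≤ N, x = w i} from Set.ext hfan.mem_iff] at hfan
  · obtain ⟨h1, h2⟩ := (hv v).2 rfl
    obtain ⟨z, hz⟩ := Set.encard_eq_one.1 h2
    have hzu : u ∈ G.neighborSet v := h1.symm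
    rw [hz] at hzu
    exact hnb (by rw [hz, Set.mem_singleton_iff.1 hzu])
  · by_cases hxC : x ∈ C'
    · rcases (hfan.mem_iff x).1 hxC with h | h
      · exact Or.inl h
      · exact Or.inr (Or.inr (Or.inl h))
    · obtain ⟨y, hyC, hy⟩ := hpend x hxC
      rcases (hfan.mem_iff y).1 hyC with rfl | ⟨i, hi, rfl⟩
      · refine Or.inr (Or.inl ((hv x).1 ⟨?_, by rw [hy, Set.encard_singleton]⟩))
        have : y ∈ G.neighborSet x := by rw [hy]; rfl
        exact G.adj_symm this
      · exact Or.inr (Or.inr (Or.inr ⟨i, hi, hnb hy⟩))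

theorem mainTheorem8 {V : Type u} [Fintype V] [DecidableEq V] (G : SimpleGraph V)
    (hG : IsSimplePartialTwoTree G) (u v : V) (hu : IsDistinguished G u)
    (hv : ∀ w, IsPendantNeighbor G u w ↔ w = v) :
    maxMult G = 2 ↔
      IsTwoParallelPaths (G.induce ({v}ᶜ : Set V)) ∧
        (IsTwoParallelPaths (G.induce ({u, v}ᶜ : Set V)) ∨
          IsPathGraph (G.induce ({u, v}ᶜ : Set V))) := by
  obtain ⟨N, w, h⟩ := hG.exists_isPendantFan hu hv
  constructor
  · intro hM
    obtain ⟨⟨r, hr, hrN, hpos, hc⟩, s, t, hst, ht, hL, hR, hpos', hc'⟩ :=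
      h.exists_separation hM.le
    refine ⟨h.isTwoParallelPaths_compl_v hst ht hL hR hpos' hc', ?_⟩
    by_cases hpath : IsPathGraph (G.induce ({u, v}ᶜ : Set V))
    · exact Or.inr hpath
    · exact Or.inl (h.isTwoParallelPaths_compl_center hr hrN hpos hc hpath)
  · rintro ⟨h1, h2⟩
    refine le_antisymm (maxMult_le_two_of_pendant h.adj_v h1.isForcedByTwo ?_) h.two_le_maxMult
    rcases h2 with h2 | h2
    · exact h2.isForcedByTwo
    · exact h2.isForcedByTwo
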